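/- **Notation.** $\mathbb R^2_+=\{x=(x^1,x^2): x^2\ge 0\}$, $D^+_t=\{x\in\mathbb R^2_+:|x|\le t\}$, $D^+=D^+_1$, $\partial^+D^+_t=\{x\in\mathbb R^2_+:|x|=t\}$, $\partial^0D_t^+=D_t^+\cap\{x^2=0\}$, $\partial^0\Omega=\Omega\cap\{x^2=0\}$; $(r,\theta)$ are polar coordinates centred at $0$, and $\partial_\theta=(-x^2,x^1)$ is the coordinate vector field, of length $r$. Let $N\subset\mathbb R^K$ be a compact smooth embedded submanifold with the induced Riemannian metric. Spinors on the plane are $\mathbb C^2$-valued functions, and the frame $e_1=\partial_{x^1}$, $e_2=\partial_{x^2}$ acts by Clifford multiplication through $e_1=\begin{pmatrix}0&1\\-1&0\end{pmatrix}$, $e_2=\begin{pmatrix}0&i\\ i&0\end{pmatrix}$. A section $\psi$ of $\Sigma\Omega\otimes\phi^*TN$ is written $\psi=(\psi^1,\dots,\psi^K)$ with spinors $\psi^k$, where $\psi(x)\in\mathbb C^2\otimes T_{\phi(x)}N\subset\mathbb C^2\otimes\mathbb R^K$, and $\langle\cdot,\cdot\rangle$ is the Hermitian product $\sum_k\langle\psi^k,\omega^k\rangle$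 (on $\mathbb R^K$-valued quantities, the Euclidean product). $\widetilde\nabla$ is the connection on $\Sigma\Omega\otimes\phi^*TN$ induced by the Levi-Civita connection of $N$ (the tangential projection of the derivative in $\mathbb C^2\otimes\mathbb R^K$), and $\slashed D\psi=\sum_\alpha e_\alpha\cdot\widetilde\nabla_{e_\alpha}\psi$. $A$ is the second fundamental form of $N$ in $\mathbb R^K$, with the sign for which harmonic maps satisfy $\Delta\phi+A(\phi)(d\phi,d\phi)=0$; $P(\xi;\cdot)$ is the shape operator, $\langle P(\xi;X),Y\rangle=\langle A(X,Y),\xi\rangle$; $A(\phi)(d\phi,d\phi)=\sum_\alpha A(\phi_\alpha,\phi_\alpha)$ with $\phi_\alpha=\partial\phi/\partial x^\alpha$, and, writing $\psi=\psi^i\otimes\partial_{y^i}$ in a local frame of $TN$, $$Re\big(P(\mathcal A(d\phi(e_\alpha),e_\alpha\cdot\psi);\psi)\big)=\sum_{\alpha,i,j}Re\langle\psi^i,e_\alpha\cdot\psi^j\rangle\,P\big(A(\phi_\alpha,\partial_{y^j});\partial_{y^i}\big).$$ **Lemma (Pohozaev type identity).** Let $D^+\subset\Omega\subset\mathbb R^2_+$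 (for example $\Omega$ a bounded smooth domain), and let $(\phi,\psi)\in C^2(\Omega,N)\times C^1(\Omega,\Sigma\Omega\otimes\phi^*TN)$, with derivatives continuous up to the flat boundary $\partial^0\Omega$, be an approximate Dirac-harmonic map: there are $\tau,h\in L^1(\Omega)$ with, almost everywhere in $\Omega$, $$\tau=\Delta\phi+A(\phi)(d\phi,d\phi)-Re\big(P(\mathcal A(d\phi(e_\alpha),e_\alpha\cdot\psi);\psi)\big),\qquad h=\slashed D\psi .$$ Suppose it has boundary data $\phi=\varphi$ and $\mathcal B\psi=\mathcal B\chi$ on $\partial^0\Omega$, where $\varphi\in C^2(\Omega,\mathbb R^K)$ is an extension of the Dirichlet data to $\Omega$ and $\mathcal B=\mathcal B^{\pm}=\frac12(Id\pm\vec n\cdot G)$ with outward normal $\vec n=-e_2$ and $G=i\,e_1\cdot e_2$. Then for every $0<t<\frac12$ the following identity holds between complex numbers: \begin{align*} t\int_{\partial^+ D^+_t}\Big(|\phi_r|^2-\tfrac{1}{2}|\nabla\phi|^2\Big)&=\tfrac{1}{2}\int_{\partial^+ D^+_t}\langle \psi,r^{-1}\partial_\theta\cdot\psi_\theta\rangle-\tfrac{1}{2}\int_{D^+_t}\langle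 \psi,\slashed D\psi\rangle\, dx-Re\int_{D^+_t}\langle \slashed D\psi,r\psi_r\rangle\, dx\\ &\quad+\int_{D^+_t}\langle r(\phi-\varphi)_r,\tau\rangle\, dx+\tfrac{1}{2}\int_{\partial^0 D^+_t}\Big\langle \psi,\frac{\partial}{\partial x^2}\cdot r\psi_r\Big\rangle\\ &\quad+\int_{\partial^+ D^+_t}r\langle\phi_r,\varphi_r\rangle-\int_{D^+_t}\sum_\alpha\Big\langle\partial_\alpha\phi,\ \partial_\alpha \varphi+r\,\partial_r(\partial_\alpha\varphi)\Big\rangle dx\\ &\quad+\int_{D^+_t}\Big\langle r\varphi_r,\ A(\phi)(d\phi,d\phi)-Re\big( P(\mathcal{A}(d\phi(e_\alpha),e_\alpha\cdot\psi);\psi)\big)\Big\rangle dx, \end{align*} where $\phi_r=\partial\phi/\partial r$, $\psi_r=\widetilde\nabla_{\partial/\partial r}\psi$, $\psi_\theta=\widetilde\nabla_{\partial/\partial\theta}\psi$, and the integrals over $\partial^+D_t^+$ and $\partial^0D_t^+$ are with respect to arc length. -/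

import Mathlib

open MeasureTheory
open scoped ContDiff

noncomputable section

namespace DiracHarmonic

/-- The plane `ℝ²` with its Euclidean metric; the coordinates `(x¹, x²)` are `x 0`, `x 1`. -/
abbrev Plane : Type := EuclideanSpace ℝ (Fin 2)

/-- The ambient Euclidean space `ℝᴷ` of the target. -/
abbrev Ambient (K : ℕ) : Type := EuclideanSpace ℝ (Fin K)

/-- The spinor module `Δ₂ = ℂ²` with its Hermitian product. -/
abbrev Spinor : Type := EuclideanSpace ℂ (Fin 2)

/-- `Δ₂ ⊗ ℝᴷ`: the element `∑ₖ ψᵏ ⊗ εₖ` is the tuple `(ψ¹, …, ψᴷ)` of spinors, and the Hermitian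
product is `⟨ψ, ω⟩ = ∑ₖ ⟨ψᵏ, ωᵏ⟩`. -/
abbrev TwistedSpinor (K : ℕ) : Type := PiLp 2 (fun _ : Fin K => Spinor)

/-! ### Subsets of the plane -/

/-- The closed upper half plane `ℝ²₊`. -/
def halfPlane : Set Plane := {x | 0 ≤ x 1}

/-- The closed upper half disc `D⁺_t` centred at the origin. -/
def halfDisc (t : ℝ) : Set Plane := {x | ‖x‖ ≤ t ∧ 0 ≤ x 1}

/-- The flat part `∂⁰Ω = Ω ∩ ∂ℝ²₊` of the boundary of `Ω ⊆ ℝ²₊`. -/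
def flatBoundary (Ω : Set Plane) : Set Plane := {x | x ∈ Ω ∧ x 1 = 0}

/-- Integral over the arc `∂⁺D⁺_t` with respect to arc length. -/
def arcIntegral {F : Type*} [NormedAddCommGroup F] [NormedSpace ℝ F]
    (t : ℝ) (f : Plane → F) : F :=
  ∫ θ in (0 : ℝ)..Real.pi, t • f !₂[t * Real.cos θ, t * Real.sin θ]

/-- Integral over the flat segment `∂⁰D⁺_t` with respect to arc length. -/
def flatIntegral {F : Type*} [NormedAddCommGroup F] [NormedSpace ℝ F]
    (t : ℝ) (f : Plane → F) : F :=
  ∫ s in (-t)..t, f !₂[s, 0]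

/-! ### Derivatives of vector-valued functions on `Ω` -/

section Derivatives

variable {F : Type*} [NormedAddCommGroup F] [NormedSpace ℝ F]

/-- The standard orthonormal frame `e₁ = ∂/∂x¹`, `e₂ = ∂/∂x²`. -/
def frame (α : Fin 2) : Plane := EuclideanSpace.single α 1

/-- The partial derivative `∂f/∂x^α` of a function on `Ω` (one-sided at the boundary of `Ω`). -/
def partialDeriv (Ω : Set Plane) (f : Plane → F) (α : Fin 2) (x : Plane) : F :=
  fderivWithin ℝ f Ω x (frame α)

/-- The radial unit vector `∂/∂r` at `x ≠ 0`. -/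
def radialVec (x : Plane) : Plane := ‖x‖⁻¹ • x

/-- The coordinate vector `∂/∂θ` at `x`, of length `r = ‖x‖`. -/
def angularVec (x : Plane) : Plane := !₂[-(x 1), x 0]

/-- The radial derivative `f_r = ∂f/∂r`. -/
def radialDeriv (Ω : Set Plane) (f : Plane → F) (x : Plane) : F :=
  fderivWithin ℝ f Ω x (radialVec x)

/-- The Laplacian `Δf = ∑_α ∂²f/∂(x^α)²`. -/
def laplacian (Ω : Set Plane) (f : Plane → F) (x : Plane) : F :=
  ∑ α, partialDeriv Ω (partialDeriv Ω f α) α x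

end Derivatives

/-! ### The target -/

/-- `N` is a smooth embedded `n`-dimensional submanifold of `ℝᴷ` (without boundary): near each of
its points there is a smooth diffeomorphism between open subsets of `ℝᴷ` that carries `N` to an
`n`-dimensional linear subspace. It carries the Riemannian metric induced from `ℝᴷ`. -/
def IsSmoothSubmanifold {K : ℕ} (n : ℕ) (N : Set (Ambient K)) : Prop :=
  ∀ p ∈ N, ∃ (e : OpenPartialHomeomorph (Ambient K) (Ambient K)) (V : Submodule ℝ (Ambient K)),
    p ∈ e.source ∧ ContDiffOn ℝ ∞ e e.source ∧ ContDiffOn ℝ ∞ e.symm e.target ∧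
    Module.finrank ℝ V = n ∧ ∀ q ∈ e.source, (q ∈ N ↔ e q ∈ V)

/-- The tangent space `T_pN ⊆ ℝᴷ`. -/
def tangentSpaceAt {K : ℕ} (N : Set (Ambient K)) (p : Ambient K) : Submodule ℝ (Ambient K) :=
  Submodule.span ℝ (tangentConeAt ℝ N p)

/-- The orthogonal projection of `ℝᴷ` onto `T_pN`. -/
def tangentProj {K : ℕ} (N : Set (Ambient K)) (p : Ambient K) : Ambient K →L[ℝ] Ambient K :=
  (tangentSpaceAt N p).starProjection

/-- The second fundamental form, `A(X, Y) = secondFF N p X Y` for `X, Y ∈ T_pN`: minus the normal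
component of the derivative in the direction `X` of the tangent vector field `q ↦ Π_q Y` extending
`Y`, where `Π_q` is the projection onto `T_qN`. The sign is the one for which harmonic maps satisfy
`Δφ + A(dφ, dφ) = 0`. (For arbitrary `X, Y` this is `A` of their tangential parts. The derivative
within `N` is only used in tangent directions, where it does not depend on choices.) -/
def secondFF {K : ℕ} (N : Set (Ambient K)) (p X : Ambient K) : Ambient K →L[ℝ] Ambient K :=
  -((ContinuousLinearMap.id ℝ (Ambient K) - tangentProj N p) ∘L
    (fderivWithin ℝ (tangentProj N) N p (tangentProj N p X)))

/-- The shape operator `P(ξ; X)`, determined by `⟨P(ξ; X), Y⟩ = ⟨A(X, Y), ξ⟩`. -/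
def shapeOp {K : ℕ} (N : Set (Ambient K)) (p ξ X : Ambient K) : Ambient K :=
  ContinuousLinearMap.adjoint (secondFF N p X) ξ

/-! ### Clifford multiplication and twisted spinors -/

/-- Clifford multiplication by `v = v¹e₁ + v²e₂` on `ℂ²` as a matrix. -/
def cliffordMatrix (v : Plane) : Matrix (Fin 2) (Fin 2) ℂ :=
  (v 0 : ℂ) • !![0, 1; -1, 0] + (v 1 : ℂ) • !![0, Complex.I; Complex.I, 0]

/-- A matrix acting on the spinor factor of `ℂ² ⊗ ℝᴷ`. -/
def spinorAct {K : ℕ} (M : Matrix (Fin 2) (Fin 2) ℂ) (ψ : TwistedSpinor K) : TwistedSpinor K :=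
  WithLp.toLp 2 fun k => (WithLp.toLp 2 (M.mulVec (ψ k)) : Spinor)

/-- Clifford multiplication `v · ψ` on `ℂ² ⊗ ℝᴷ`. -/
def clifford {K : ℕ} (v : Plane) (ψ : TwistedSpinor K) : TwistedSpinor K :=
  spinorAct (cliffordMatrix v) ψ

/-- The endomorphism `id ⊗ L` of `ℂ² ⊗ ℝᴷ`, where `L : ℝᴷ → ℝᴷ` is linear. -/
def idTensor {K : ℕ} (L : Ambient K →L[ℝ] Ambient K) (ψ : TwistedSpinor K) : TwistedSpinor K :=
  WithLp.toLp 2 fun k => ∑ j, (L (EuclideanSpace.single j 1)) k • ψ j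

/-- `ψ` is a section of `ΣΩ ⊗ φ*TN` over `Ω`: `ψ(x) ∈ ℂ² ⊗ T_{φ(x)}N`. -/
def IsSectionAlong {K : ℕ} (N : Set (Ambient K)) (Ω : Set Plane) (φ : Plane → Ambient K)
    (ψ : Plane → TwistedSpinor K) : Prop :=
  ∀ x ∈ Ω, idTensor (tangentProj N (φ x)) (ψ x) = ψ x

/-- The covariant derivative `∇̃_v ψ` at `x` on `ΣΩ ⊗ φ*TN`: the spinor bundle is flat and `φ*TN`
carries the pull-back of the Levi-Civita connection of `N ⊆ ℝᴷ`, that is, the tangential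
projection of the derivative in `ℝᴷ`. -/
def covDeriv {K : ℕ} (N : Set (Ambient K)) (Ω : Set Plane) (φ : Plane → Ambient K)
    (ψ : Plane → TwistedSpinor K) (x v : Plane) : TwistedSpinor K :=
  idTensor (tangentProj N (φ x)) (fderivWithin ℝ ψ Ω x v)

/-- The Dirac operator along `φ`, `D̸ψ = ∑_α e_α · ∇̃_{e_α} ψ`. -/
def diracAlong {K : ℕ} (N : Set (Ambient K)) (Ω : Set Plane) (φ : Plane → Ambient K)
    (ψ : Plane → TwistedSpinor K) (x : Plane) : TwistedSpinor K :=
  ∑ α, clifford (frame α) (covDeriv N Ω φ ψ x (frame α))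

/-- `A(φ)(dφ, dφ) = ∑_α A(φ_α, φ_α)`. -/
def secondFFTerm {K : ℕ} (N : Set (Ambient K)) (Ω : Set Plane) (φ : Plane → Ambient K)
    (x : Plane) : Ambient K :=
  ∑ α, secondFF N (φ x) (partialDeriv Ω φ α x) (partialDeriv Ω φ α x)

/-- `Re (P(𝒜(dφ(e_α), e_α · ψ); ψ)) = ∑_α ∑_{i,j} Re⟨ψⁱ, e_α · ψʲ⟩ P(A(φ_α, ε_j); ε_i)`,
for `ψ = ∑ᵢ ψⁱ ⊗ ε_i` in the standard basis `ε_i` of `ℝᴷ`. -/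
def spinorShapeTerm {K : ℕ} (N : Set (Ambient K)) (Ω : Set Plane) (φ : Plane → Ambient K)
    (ψ : Plane → TwistedSpinor K) (x : Plane) : Ambient K :=
  ∑ α, ∑ i, ∑ j, (inner ℂ (ψ x i) (clifford (frame α) (ψ x) j)).re •
    shapeOp N (φ x)
      (secondFF N (φ x) (partialDeriv Ω φ α x) (EuclideanSpace.single j 1))
      (EuclideanSpace.single i 1)

/-! ### Approximate Dirac-harmonic maps -/

/-- The pair `(φ, ψ)`, of class `C² × C¹`, is an approximate Dirac-harmonic map from `Ω` to `N`
with error terms `(τ, h)`. -/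
structure IsApproxDiracHarmonic {K : ℕ} (N : Set (Ambient K)) (Ω : Set Plane)
    (φ : Plane → Ambient K) (ψ : Plane → TwistedSpinor K)
    (τ : Plane → Ambient K) (h : Plane → TwistedSpinor K) : Prop where
  contDiffOn_map : ContDiffOn ℝ 2 φ Ω
  mapsTo : Set.MapsTo φ Ω N
  contDiffOn_spinor : ContDiffOn ℝ 1 ψ Ω
  isSection : IsSectionAlong N Ω φ ψ
  integrableOn_tau : IntegrableOn τ Ω
  integrableOn_h : IntegrableOn h Ω
  tau_eq : ∀ᵐ x ∂(volume.restrict Ω),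
    τ x = laplacian Ω φ x + secondFFTerm N Ω φ x - spinorShapeTerm N Ω φ ψ x
  h_eq : ∀ᵐ x ∂(volume.restrict Ω), h x = diracAlong N Ω φ ψ x

/-- The chiral boundary operator `𝓑^± ψ = ½ (Id ± n · G) · ψ`, where `G = i e₁ · e₂`; the sign is
`s = ±1`. -/
def chiralOp {K : ℕ} (s : ℤˣ) (n : Plane) (ψ : TwistedSpinor K) : TwistedSpinor K :=
  (1 / 2 : ℂ) • (ψ + ((s : ℤ) : ℂ) •
    clifford n (Complex.I • clifford (frame 0) (clifford (frame 1) ψ)))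

/-- The boundary conditions `φ = φ₀`, `𝓑ψ = 𝓑χ` on `∂⁰Ω`, with outward unit normal `-e₂`. -/
structure HasBoundaryData {K : ℕ} (s : ℤˣ) (Ω : Set Plane)
    (φ : Plane → Ambient K) (ψ : Plane → TwistedSpinor K)
    (φ₀ : Plane → Ambient K) (χ : Plane → TwistedSpinor K) : Prop where
  dirichlet : ∀ x ∈ flatBoundary Ω, φ x = φ₀ x
  chiral : ∀ x ∈ flatBoundary Ω,
    chiralOp s (-frame 1) (ψ x) = chiralOp s (-frame 1) (χ x)

end DiracHarmonic

end

/-! The identity comes from testing both equations against the conformal field `X = r∂_r`, the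
generator of dilations, which is tangent to the flat side of the half disc.

Map part. For `u = φ` and `u = φ₀`, the divergence theorem is applied to the field with components
`⟨r u_r, ∂_αφ⟩` (`integral_inner_laplacian`), and also to `½|∇φ|² x`
(`integral_dilationDensity_self`). On the flat side `rφ_r = r(φ₀)_r`, because `X` differentiates
along the boundary, where the two maps agree; hence the unknown boundary integral of the normal
derivative of `φ` drops out of the difference. This gives `pohozaev_map`, with `Δφ` still to be
replaced through the equation.

Spinor part. Green's theorem is applied to the 1-form `⟨ψ, ∂_θ·dψ⟩`. Its exterior derivative has
density `⟨ψ, ∑ e_α·∂_αψ⟩ + 2 Re⟨∂₁ψ, ∂_θ·∂₂ψ⟩`. The derivative of a section splits as `∂_αψ = ∇̃_αψ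
- A(φ_α)ψ`, tangential plus normal (`fderivWithin_section_eq`). The mixed terms vanish; by one
algebraic identity the tangential pair gives `Re⟨D̸ψ, rψ_r⟩` and the normal pair gives `rφ_r` tested
against the spinorial force. The force is thus computed by `pohozaev_spinor`, and inserting it into
the map part gives the theorem.

Two points need care. The spinor is only `C¹`, so Green's theorem must be proved for `f dg` without
second derivatives; this works since `d(f dg) = df ∧ dg`. And `N` is an arbitrary submanifold, so
differentiability of the tangent projection and symmetry of `A` are derived from flattening charts.
-/

namespace DiracHarmonic

/-! ### Stokes' theorem for `f dg` on a rectangle, in class `C¹`. -/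

section Rectangle

open Filter Topology Set intervalIntegral

variable {E F G : Type*} [NormedAddCommGroup E] [NormedSpace ℝ E] [NormedAddCommGroup F]
  [NormedSpace ℝ F] [NormedAddCommGroup G] [NormedSpace ℝ G] [CompleteSpace G]

/-- Derivatives are asked for only in the open interval: along a half circle the data are not
defined past the two endpoints. -/
theorem integral_bilin_sub_eq (B : E →L[ℝ] F →L[ℝ] G) {c d : ℝ} (hcd : c ≤ d)
    {u u' : ℝ → E} {v v' : ℝ → F} (hu : Continuous u) (hv : Continuous v)
    (hu' : Continuous u') (hv' : Continuous v')
    (du : ∀ θ ∈ Ioo c d, HasDerivAt u (u' θ) θ) (dv : ∀ θ ∈ Ioo c d, HasDerivAt v (v' θ) θ) :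
    ∫ θ in c..d, B (u θ) (v' θ) =
      B (u d) (v d) - B (u c) (v c) - ∫ θ in c..d, B (u' θ) (v θ) := by
  have h1 : Continuous fun θ => B (u θ) (v' θ) := by fun_prop
  have h2 : Continuous fun θ => B (u' θ) (v θ) := by fun_prop
  have h3 : Continuous fun θ => B (u θ) (v θ) := by fun_prop
  have := integral_eq_sub_of_hasDerivAt_of_le (f := fun θ => B (u θ) (v θ))
    (f' := fun θ => B (u θ) (v' θ) + B (u' θ) (v θ)) hcd h3.continuousOn
    (fun θ hθ => B.hasDerivAt_of_bilinear (fun _ => du θ hθ) (fun _ => dv θ hθ))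
    ((h1.add h2).intervalIntegrable _ _)
  rw [integral_add (h1.intervalIntegrable _ _) (h2.intervalIntegrable _ _)] at this
  rw [← this]; abel

theorem exists_bound_on_rectangle {X : Type*} [NormedAddCommGroup X] (a b c d : ℝ) (w : ℝ → ℝ → X)
    (hw : Continuous (Function.uncurry w)) :
    ∃ K, ∀ s ∈ Icc a b, ∀ θ ∈ Icc c d, ‖w s θ‖ ≤ K := by
  obtain ⟨K, hK⟩ := (isCompact_Icc.prod isCompact_Icc :
    IsCompact (Icc a b ×ˢ Icc c d)).exists_bound_of_continuousOn hw.continuousOn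
  exact ⟨K, fun s hs θ hθ => hK (s, θ) ⟨hs, hθ⟩⟩

theorem tendsto_inv_smul_sub {r : ℝ} {w : ℝ → E} {w' : E} (hw : HasDerivAt w w' r) :
    Tendsto (fun s => (s - r)⁻¹ • (w s - w r)) (𝓝[≠] r) (𝓝 w') := by
  simpa [slope_fun_def, hasDerivAt_iff_tendsto_slope] using hw

/-- The mean value inequality, providing a bound on difference quotients that is uniform in the
angular parameter and so serves as a dominating constant. -/
theorem norm_inv_smul_sub_le {a b r K : ℝ} {w w' : ℝ → E}
    (dw : ∀ r ∈ Ioo a b, HasDerivAt w (w' r) r) (hK : ∀ r ∈ Ioo a b, ‖w' r‖ ≤ K)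
    (hr : r ∈ Ioo a b) {s : ℝ} (hs : s ∈ Ioo a b) (hsr : s ≠ r) :
    ‖(s - r)⁻¹ • (w s - w r)‖ ≤ K := by
  have := (convex_Ioo a b).norm_image_sub_le_of_norm_hasDerivWithin_le
    (fun x hx => (dw x hx).hasDerivWithinAt) hK hr hs
  have hp : 0 < |s - r| := abs_pos.2 (sub_ne_zero.2 hsr)
  rw [norm_smul, norm_inv, Real.norm_eq_abs, inv_mul_le_iff₀ hp]
  rw [Real.norm_eq_abs] at this
  linarith

/-- Differentiation of `∫ f dg` along a family of curves: only first derivatives are needed. -/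
theorem hasDerivAt_integral_bilin (B : E →L[ℝ] F →L[ℝ] G) {a b c d : ℝ} (hcd : c ≤ d)
    {f f1 f2 : ℝ → ℝ → E} {g g1 g2 : ℝ → ℝ → F}
    (hf : Continuous (Function.uncurry f)) (hf1 : Continuous (Function.uncurry f1))
    (hf2 : Continuous (Function.uncurry f2)) (hg : Continuous (Function.uncurry g))
    (hg1 : Continuous (Function.uncurry g1)) (hg2 : Continuous (Function.uncurry g2))
    (df1 : ∀ r ∈ Ioo a b, ∀ θ ∈ Icc c d, HasDerivAt (fun s => f s θ) (f1 r θ) r)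
    (dg1 : ∀ r ∈ Ioo a b, ∀ θ ∈ Icc c d, HasDerivAt (fun s => g s θ) (g1 r θ) r)
    (df2 : ∀ r ∈ Ioo a b, ∀ θ ∈ Ioo c d, HasDerivAt (f r) (f2 r θ) θ)
    (dg2 : ∀ r ∈ Ioo a b, ∀ θ ∈ Ioo c d, HasDerivAt (g r) (g2 r θ) θ)
    {r : ℝ} (hr : r ∈ Ioo a b) :
    HasDerivAt (fun s => ∫ θ in c..d, B (f s θ) (g2 s θ))
      ((∫ θ in c..d, (B (f1 r θ) (g2 r θ) - B (f2 r θ) (g1 r θ))) +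
        (B (f r d) (g1 r d) - B (f r c) (g1 r c))) r := by
  have cf : ∀ s, Continuous (f s) := fun s => hf.comp (by fun_prop : Continuous fun θ => (s, θ))
  have cf2 : ∀ s, Continuous (f2 s) := fun s => hf2.comp (by fun_prop : Continuous fun θ => (s, θ))
  have cg : ∀ s, Continuous (g s) := fun s => hg.comp (by fun_prop : Continuous fun θ => (s, θ))
  have cg2 : ∀ s, Continuous (g2 s) := fun s => hg2.comp (by fun_prop : Continuous fun θ => (s, θ))
  obtain ⟨K1, hK1⟩ := exists_bound_on_rectangle a b c d f1 hf1
  obtain ⟨K2, hK2⟩ := exists_bound_on_rectangle a b c d g2 hg2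
  obtain ⟨K3, hK3⟩ := exists_bound_on_rectangle a b c d f2 hf2
  obtain ⟨K4, hK4⟩ := exists_bound_on_rectangle a b c d g1 hg1
  have hrI := Ioo_subset_Icc_self hr
  -- Write the increment as `∫ (f_s - f_r) ∂_θg_s + ∫ f_r ∂_θ(g_s - g_r)` and integrate the second
  -- term by parts in `θ`. Only difference quotients of `f` and `g` in `s` then remain, never one of
  -- `∂_θg`, so no mixed second derivative is needed.
  have slope_eq : ∀ᶠ s in 𝓝[≠] r, slope (fun s => ∫ θ in c..d, B (f s θ) (g2 s θ)) r s =
      (∫ θ in c..d, (B ((s - r)⁻¹ • (f s θ - f r θ)) (g2 s θ)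
        - B (f2 r θ) ((s - r)⁻¹ • (g s θ - g r θ)))) +
      (B (f r d) ((s - r)⁻¹ • (g s d - g r d)) - B (f r c) ((s - r)⁻¹ • (g s c - g r c))) := by
    filter_upwards [nhdsWithin_le_nhds (Ioo_mem_nhds hr.1 hr.2)] with s hs
    have ibp := integral_bilin_sub_eq B hcd (cf r) ((cg s).sub (cg r)) (cf2 r)
      ((cg2 s).sub (cg2 r)) (df2 r hr) (fun θ hθ => (dg2 s hs θ hθ).sub (dg2 r hr θ hθ))
    have i0 : ∀ s, IntervalIntegrable (fun θ => B (f r θ) (g2 s θ)) volume c d := fun s =>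
      ((B.continuous.comp (cf r)).clm_apply (cg2 s)).intervalIntegrable _ _
    have i1 : IntervalIntegrable (fun θ => B (f s θ) (g2 s θ)) volume c d :=
      ((B.continuous.comp (cf s)).clm_apply (cg2 s)).intervalIntegrable _ _
    have i2 : IntervalIntegrable (fun θ => B (f s θ - f r θ) (g2 s θ)) volume c d :=
      ((B.continuous.comp ((cf s).sub (cf r))).clm_apply (cg2 s)).intervalIntegrable _ _
    have i3 : IntervalIntegrable (fun θ => B (f2 r θ) (g s θ - g r θ)) volume c d :=
      ((B.continuous.comp (cf2 r)).clm_apply ((cg s).sub (cg r))).intervalIntegrable _ _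
    have key : (∫ θ in c..d, B (f s θ) (g2 s θ)) - ∫ θ in c..d, B (f r θ) (g2 r θ) =
        (∫ θ in c..d, (B (f s θ - f r θ) (g2 s θ) - B (f2 r θ) (g s θ - g r θ))) +
        (B (f r d) (g s d - g r d) - B (f r c) (g s c - g r c)) := by
      rw [integral_sub i2 i3]
      have : (∫ θ in c..d, B (f s θ) (g2 s θ)) - ∫ θ in c..d, B (f r θ) (g2 r θ) =
          (∫ θ in c..d, B (f s θ - f r θ) (g2 s θ)) +
            ∫ θ in c..d, B (f r θ) ((g2 s - g2 r) θ) := by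
        have e1 : (fun θ => B (f r θ) ((g2 s - g2 r) θ)) =
            fun θ => B (f r θ) (g2 s θ) - B (f r θ) (g2 r θ) := by
          funext θ; simp
        have e2 : (fun θ => B (f s θ - f r θ) (g2 s θ)) =
            fun θ => B (f s θ) (g2 s θ) - B (f r θ) (g2 s θ) := by
          funext θ; simp
        rw [e1, e2, integral_sub i1 (i0 s), integral_sub (i0 s) (i0 r)]; abel
      rw [this]
      simp only [Pi.sub_apply] at ibp ⊢
      rw [ibp]; abel
    rw [slope_def_module, key, smul_add, ← intervalIntegral.integral_smul]
    congr 1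
    · congr 1; funext θ
      simp only [smul_sub, map_sub, map_smul, smul_apply, sub_apply]
    · simp only [smul_sub, map_sub, map_smul]
  rw [hasDerivAt_iff_tendsto_slope]
  refine Tendsto.congr' (slope_eq.mono fun _ h => h.symm) ?_
  have hd : d ∈ Icc c d := right_mem_Icc.2 hcd
  have hc : c ∈ Icc c d := left_mem_Icc.2 hcd
  refine Tendsto.add ?_ (Tendsto.sub
    (((B (f r d)).continuous.tendsto _).comp (tendsto_inv_smul_sub (dg1 r hr d hd)))
    (((B (f r c)).continuous.tendsto _).comp (tendsto_inv_smul_sub (dg1 r hr c hc))))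
  -- The quotients of `f` and `g` are bounded by the suprema `K1` and `K4` of their radial
  -- derivatives; `K2` and `K3` bound the angular derivatives they are paired with.
  refine tendsto_integral_filter_of_dominated_convergence
    (fun _ => ‖B‖ * K1 * K2 + ‖B‖ * K3 * K4) (Eventually.of_forall fun s => ?_) ?_ ?_ ?_
  · refine Continuous.aestronglyMeasurable ?_
    exact ((B.continuous.comp (((cf s).sub (cf r)).const_smul _)).clm_apply (cg2 s)).sub
      ((B.continuous.comp (cf2 r)).clm_apply (((cg s).sub (cg r)).const_smul _))
  · filter_upwards [nhdsWithin_le_nhds (Ioo_mem_nhds hr.1 hr.2), self_mem_nhdsWithin] with s hs hne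
    refine Eventually.of_forall fun θ hθ => ?_
    have hθ' : θ ∈ Icc c d := Ioc_subset_Icc_self (by rwa [uIoc_of_le hcd] at hθ)
    have hsI := Ioo_subset_Icc_self hs
    have n1 := norm_inv_smul_sub_le (fun r hr => df1 r hr θ hθ')
      (fun r hr => hK1 r (Ioo_subset_Icc_self hr) θ hθ') hr hs hne
    have n2 := norm_inv_smul_sub_le (fun r hr => dg1 r hr θ hθ')
      (fun r hr => hK4 r (Ioo_subset_Icc_self hr) θ hθ') hr hs hne
    have p1 : 0 ≤ K1 := (norm_nonneg _).trans n1
    have p3 : 0 ≤ K3 := (norm_nonneg _).trans (hK3 r hrI θ hθ')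
    refine (norm_sub_le _ _).trans (add_le_add ?_ ?_)
    · refine (B.le_opNorm₂ _ _).trans ?_
      gcongr
      exact hK2 s hsI θ hθ'
    · refine (B.le_opNorm₂ _ _).trans ?_
      gcongr
      exact hK3 r hrI θ hθ'
  · exact intervalIntegrable_const
  · refine Eventually.of_forall fun θ hθ => ?_
    have hθ' : θ ∈ Icc c d := Ioc_subset_Icc_self (by rwa [uIoc_of_le hcd] at hθ)
    have t2 : Tendsto (fun s => g2 s θ) (𝓝[≠] r) (𝓝 (g2 r θ)) :=
      ((hg2.comp (by fun_prop : Continuous fun s => (s, θ))).tendsto r).mono_left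
        nhdsWithin_le_nhds
    have t1 := tendsto_inv_smul_sub (df1 r hr θ hθ')
    have t4 := tendsto_inv_smul_sub (dg1 r hr θ hθ')
    refine Tendsto.sub ?_ (((B (f2 r θ)).continuous.tendsto _).comp t4)
    exact (B.continuous₂.tendsto (f1 r θ, g2 r θ)).comp (t1.prodMk_nhds t2)

/-- Stokes' theorem for `f dg` on a rectangle, with `f` and `g` of class `C¹` only. -/
theorem integral_bilin_rectangle (B : E →L[ℝ] F →L[ℝ] G) {a b c d : ℝ} (hab : a ≤ b) (hcd : c ≤ d)
    {f f1 f2 : ℝ → ℝ → E} {g g1 g2 : ℝ → ℝ → F}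
    (hf : Continuous (Function.uncurry f)) (hf1 : Continuous (Function.uncurry f1))
    (hf2 : Continuous (Function.uncurry f2)) (hg : Continuous (Function.uncurry g))
    (hg1 : Continuous (Function.uncurry g1)) (hg2 : Continuous (Function.uncurry g2))
    (df1 : ∀ r ∈ Ioo a b, ∀ θ ∈ Icc c d, HasDerivAt (fun s => f s θ) (f1 r θ) r)
    (dg1 : ∀ r ∈ Ioo a b, ∀ θ ∈ Icc c d, HasDerivAt (fun s => g s θ) (g1 r θ) r)
    (df2 : ∀ r ∈ Ioo a b, ∀ θ ∈ Ioo c d, HasDerivAt (f r) (f2 r θ) θ)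
    (dg2 : ∀ r ∈ Ioo a b, ∀ θ ∈ Ioo c d, HasDerivAt (g r) (g2 r θ) θ) :
    (∫ θ in c..d, B (f b θ) (g2 b θ)) - (∫ θ in c..d, B (f a θ) (g2 a θ)) =
      (∫ r in a..b, ∫ θ in c..d, (B (f1 r θ) (g2 r θ) - B (f2 r θ) (g1 r θ))) +
        ((∫ r in a..b, B (f r d) (g1 r d)) - ∫ r in a..b, B (f r c) (g1 r c)) := by
  have cB : ∀ {u : ℝ → ℝ → E} {v : ℝ → ℝ → F}, Continuous (Function.uncurry u) →
      Continuous (Function.uncurry v) →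
      Continuous (Function.uncurry fun r θ => B (u r θ) (v r θ)) := fun hu hv =>
    (B.continuous.comp hu).clm_apply hv
  have c1 : Continuous fun r => ∫ θ in c..d, (B (f1 r θ) (g2 r θ) - B (f2 r θ) (g1 r θ)) :=
    continuous_parametric_intervalIntegral_of_continuous' ((cB hf1 hg2).sub (cB hf2 hg1)) _ _
  have c2 : ∀ θ, Continuous fun r => B (f r θ) (g1 r θ) := fun θ =>
    (cB hf hg1).comp (by fun_prop : Continuous fun r => (r, θ))
  have c3 : Continuous fun r => ∫ θ in c..d, B (f r θ) (g2 r θ) :=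
    continuous_parametric_intervalIntegral_of_continuous' (cB hf hg2) _ _
  rw [← integral_eq_sub_of_hasDerivAt_of_le hab c3.continuousOn
    (fun r hr => hasDerivAt_integral_bilin B hcd hf hf1 hf2 hg hg1 hg2 df1 dg1 df2 dg2 hr)
    ((c1.add ((c2 d).sub (c2 c))).intervalIntegrable _ _),
    integral_add (g := fun r => B (f r d) (g1 r d) - B (f r c) (g1 r c))
      (c1.intervalIntegrable _ _) (((c2 d).sub (c2 c)).intervalIntegrable _ _),
    integral_sub ((c2 d).intervalIntegrable _ _) ((c2 c).intervalIntegrable _ _)]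

end Rectangle

/-! ### The half ball, polar coordinates, and integration over half discs. -/

section HalfBall

open Filter Topology Set

/-- The part of the open unit disc that lies in the closed upper half plane. -/
def halfBall : Set Plane := {x | ‖x‖ < 1 ∧ 0 ≤ x 1}

theorem halfBall_eq : halfBall = Metric.ball 0 1 ∩ halfPlane := by
  ext x; simp [halfBall, halfPlane]

theorem halfDisc_subset_halfBall {t : ℝ} (ht : t < 1) : halfDisc t ⊆ halfBall :=
  fun _ hx => ⟨hx.1.trans_lt ht, hx.2⟩

theorem convex_halfPlane : Convex ℝ halfPlane :=
  convex_halfSpace_ge (f := fun x : Plane => x 1) ⟨fun _ _ => rfl, fun _ _ => rfl⟩ 0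

theorem convex_halfBall : Convex ℝ halfBall := by
  rw [halfBall_eq]
  exact (convex_ball 0 1).inter convex_halfPlane

theorem nonempty_interior_halfBall : (interior halfBall).Nonempty := by
  have ho : IsOpen (Metric.ball (0 : Plane) 1 ∩ {x : Plane | 0 < x 1}) :=
    Metric.isOpen_ball.inter (isOpen_lt continuous_const (by fun_prop))
  have hsub : Metric.ball (0 : Plane) 1 ∩ {x : Plane | 0 < x 1} ⊆ halfBall := by
    rw [halfBall_eq]
    exact inter_subset_inter_right _ fun x (hx : 0 < x 1) => hx.le
  refine ⟨EuclideanSpace.single 1 (1 / 2), interior_maximal hsub ho ⟨?_, ?_⟩⟩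
  · simp; norm_num
  · simp

theorem uniqueDiffOn_halfBall : UniqueDiffOn ℝ halfBall :=
  uniqueDiffOn_convex convex_halfBall nonempty_interior_halfBall

theorem halfBall_subset {Ω : Set Plane} (hDΩ : halfDisc 1 ⊆ Ω) : halfBall ⊆ Ω :=
  fun _ hx => hDΩ ⟨hx.1.le, hx.2⟩

/-- `Ω` is only constrained to lie between the unit half disc and the half plane. At points of norm
less than one it is locally the convex set `halfBall`, so derivatives within `Ω` can be handled
there as derivatives within a set of unique differentiability. -/
theorem nhdsWithin_eq_halfBall {Ω : Set Plane} (hDΩ : halfDisc 1 ⊆ Ω) (hΩ : Ω ⊆ halfPlane)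
    {x : Plane} (hx : x ∈ halfBall) : 𝓝[Ω] x = 𝓝[halfBall] x := by
  have : halfBall = Ω ∩ Metric.ball 0 1 := by
    ext y
    rw [halfBall_eq]
    refine ⟨fun hy => ⟨hDΩ ⟨?_, hy.2⟩, hy.1⟩, fun hy => ⟨hy.2, hΩ hy.1⟩⟩
    simpa using (mem_ball_zero_iff.1 hy.1).le
  rw [this, nhdsWithin_inter_of_mem']
  exact nhdsWithin_le_nhds (Metric.isOpen_ball.mem_nhds (by simpa using hx.1))

/-- The point with polar coordinates `(r, θ)`. -/
noncomputable def polarPoint (r θ : ℝ) : Plane := !₂[r * Real.cos θ, r * Real.sin θ]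

theorem norm_polarPoint (r θ : ℝ) : ‖polarPoint r θ‖ = |r| := by
  rw [EuclideanSpace.norm_eq, ← Real.sqrt_sq_eq_abs]
  congr 1
  simp only [polarPoint, Fin.sum_univ_two, Real.norm_eq_abs, sq_abs]
  simp
  linear_combination r ^ 2 * Real.cos_sq_add_sin_sq θ

theorem continuous_polarPoint : Continuous fun p : ℝ × ℝ => polarPoint p.1 p.2 := by
  unfold polarPoint
  refine (PiLp.continuous_toLp 2 _).comp (continuous_pi fun i => ?_)
  fin_cases i <;> simp <;> fun_prop

theorem polarPoint_mem_halfDisc {r θ t : ℝ} (hr : r ∈ Icc 0 t) (hθ : θ ∈ Icc 0 Real.pi) :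
    polarPoint r θ ∈ halfDisc t := by
  refine ⟨?_, ?_⟩
  · rw [norm_polarPoint, abs_of_nonneg hr.1]; exact hr.2
  · have : 0 ≤ r * Real.sin θ := mul_nonneg hr.1 (Real.sin_nonneg_of_nonneg_of_le_pi hθ.1 hθ.2)
    simpa [polarPoint] using this

theorem isCompact_halfDisc (t : ℝ) : IsCompact (halfDisc t) := by
  have : halfDisc t = Metric.closedBall 0 t ∩ {x : Plane | 0 ≤ x 1} := by
    ext x; simp [halfDisc]
  rw [this]
  exact (isCompact_closedBall 0 t).inter_right (isClosed_le continuous_const (by fun_prop))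

theorem hasDerivAt_polarPoint_radial (r θ : ℝ) :
    HasDerivAt (fun s => polarPoint s θ) (polarPoint 1 θ) r := by
  unfold polarPoint
  have := (hasDerivAt_id r).smul_const (polarPoint 1 θ)
  refine (this.congr_deriv (one_smul _ _)).congr_of_eventuallyEq (Eventually.of_forall fun s => ?_)
  ext i; fin_cases i <;> simp [polarPoint]

theorem hasDerivAt_polarPoint_angular (r θ : ℝ) :
    HasDerivAt (polarPoint r) (angularVec (polarPoint r θ)) θ := by
  have h1 := ((Real.hasDerivAt_cos θ).const_mul r).smul_const (frame 0)
  have h2 := ((Real.hasDerivAt_sin θ).const_mul r).smul_const (frame 1)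
  refine ((h1.add h2).congr_deriv ?_).congr_of_eventuallyEq (Eventually.of_forall fun s => ?_)
  · ext i; fin_cases i <;> simp [polarPoint, angularVec, frame]
  · ext i; fin_cases i <;> simp [polarPoint, frame]

theorem volume_preserving_plane_prod :
    MeasurePreserving (fun x : Plane => (x 0, x 1)) volume volume :=
  (volume_preserving_finTwoArrow ℝ).comp
    (EuclideanSpace.volume_preserving_symm_measurableEquiv_toLp (Fin 2))

theorem measurableSet_halfDisc (t : ℝ) : MeasurableSet (halfDisc t) :=
  (isCompact_halfDisc t).isClosed.measurableSet

variable {E : Type*} [NormedAddCommGroup E] [NormedSpace ℝ E]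

theorem integral_plane_eq_prod (u : Plane → E) :
    ∫ x, u x = ∫ p : ℝ × ℝ, u !₂[p.1, p.2] := by
  have e : MeasurableEmbedding (fun x : Plane => (x 0, x 1)) :=
    ((MeasurableEquiv.toLp 2 (Fin 2 → ℝ)).symm.trans
      MeasurableEquiv.finTwoArrow).measurableEmbedding
  rw [← volume_preserving_plane_prod.integral_comp e]
  congr 1; funext x; congr 1
  ext i; fin_cases i <;> rfl

/-- Integration over a half disc in polar coordinates. -/
theorem integral_halfDisc_eq_polar {t : ℝ} (ht : 0 ≤ t) {u : Plane → E}
    (hu : ContinuousOn u (halfDisc t)) :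
    ∫ x in halfDisc t, u x =
      ∫ r in (0 : ℝ)..t, ∫ θ in (0 : ℝ)..Real.pi, r • u (polarPoint r θ) := by
  have hpi := Real.pi_pos
  set w : ℝ × ℝ → E := fun p => p.1 • u (polarPoint p.1 p.2) with hw
  have cw : ContinuousOn w (Icc 0 t ×ˢ Icc 0 Real.pi) :=
    continuousOn_fst.smul (hu.comp continuous_polarPoint.continuousOn
      fun p hp => polarPoint_mem_halfDisc hp.1 hp.2)
  have iw : IntegrableOn w (Ioc 0 t ×ˢ Ioc 0 Real.pi) :=
    (cw.integrableOn_compact (isCompact_Icc.prod isCompact_Icc)).mono_set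
      (prod_mono Ioc_subset_Icc_self Ioc_subset_Icc_self)
  have iset : (∫ p in Ioc 0 t ×ˢ Ioc 0 Real.pi, w p) =
      ∫ r in (0 : ℝ)..t, ∫ θ in (0 : ℝ)..Real.pi, r • u (polarPoint r θ) := by
    rw [Measure.volume_eq_prod, setIntegral_prod w (by rwa [← Measure.volume_eq_prod])]
    simp only [intervalIntegral.integral_of_le ht, intervalIntegral.integral_of_le hpi.le, hw]
  rw [← iset, ← integral_indicator (measurableSet_halfDisc t), integral_plane_eq_prod,
    ← integral_comp_polarCoord_symm, polarCoord_target]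
  -- Polar angles run through `(-π, π)`, where the upper half plane is exactly `0 ≤ θ < π`; the
  -- endpoints are exchanged up to a null set to match this.
  have hae : (Ioc 0 t ×ˢ Ioc 0 Real.pi : Set (ℝ × ℝ)) =ᵐ[volume]
      (Ioc 0 t ×ˢ Ico 0 Real.pi : Set (ℝ × ℝ)) := by
    rw [Measure.volume_eq_prod]
    exact Measure.set_prod_ae_eq (ae_eq_refl _)
      (Ioo_ae_eq_Ioc.symm.trans Ioo_ae_eq_Ico)
  rw [setIntegral_congr_set hae, ← integral_indicator (measurableSet_Ioc.prod measurableSet_Ico),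
    ← integral_indicator (measurableSet_Ioi.prod measurableSet_Ioo)]
  congr 1; funext ⟨r, θ⟩
  have hp : (!₂[(polarCoord.symm (r, θ)).1, (polarCoord.symm (r, θ)).2] : Plane) =
      polarPoint r θ := rfl
  by_cases h : (r, θ) ∈ (Ioi 0 ×ˢ Ioo (-Real.pi) Real.pi : Set (ℝ × ℝ))
  · rw [indicator_of_mem h]
    obtain ⟨hr, hθ1, hθ2⟩ := h
    simp only [mem_Ioi] at hr hθ1 hθ2
    simp only [hp]
    have hiff : polarPoint r θ ∈ halfDisc t ↔ (r, θ) ∈ (Ioc 0 t ×ˢ Ico 0 Real.pi : Set _) := by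
      have hs : 0 ≤ r * Real.sin θ ↔ 0 ≤ θ := by
        rw [mul_nonneg_iff_of_pos_left hr]
        refine ⟨fun h => ?_, fun h => Real.sin_nonneg_of_nonneg_of_le_pi h hθ2.le⟩
        by_contra! hneg
        exact absurd h (not_le.2 (Real.sin_neg_of_neg_of_neg_pi_lt hneg hθ1))
      have e1 : (polarPoint r θ) 1 = r * Real.sin θ := rfl
      simp only [halfDisc, mem_ofPred_eq, norm_polarPoint, abs_of_pos hr, e1, hs, mem_prod, mem_Ioc,
        mem_Ico]
      tauto
    by_cases hm : polarPoint r θ ∈ halfDisc t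
    · rw [indicator_of_mem hm, indicator_of_mem (hiff.1 hm)]
    · rw [indicator_of_notMem hm, indicator_of_notMem (fun h => hm (hiff.2 h)), smul_zero]
  · rw [indicator_of_notMem h, indicator_of_notMem]
    rintro ⟨hr, hθ⟩
    exact h ⟨hr.1, lt_of_lt_of_le (neg_lt_zero.2 hpi) hθ.1, hθ.2⟩

end HalfBall

/-! ### Green's theorem and the divergence theorem on half discs. -/

section Green

open Filter Topology Set

variable {E F G : Type*} [NormedAddCommGroup E] [NormedSpace ℝ E] [NormedAddCommGroup F]
  [NormedSpace ℝ F] [NormedAddCommGroup G] [NormedSpace ℝ G]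

theorem eq_sum_frame (v : Plane) : v = v 0 • frame 0 + v 1 • frame 1 := by
  ext i; fin_cases i <;> simp [frame]

theorem map_eq_sum_frame (L : Plane →L[ℝ] E) (v : Plane) :
    L v = v 0 • L (frame 0) + v 1 • L (frame 1) := by
  conv_lhs => rw [eq_sum_frame v]
  simp

/-- The Jacobian of polar coordinates: `df ∧ dg` evaluated on `(∂_r, ∂_θ)` is `r` times its value on
`(e₁, e₂)`. -/
theorem bilin_polar_frame (B : E →L[ℝ] F →L[ℝ] G) (L : Plane →L[ℝ] E) (M : Plane →L[ℝ] F)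
    (r θ : ℝ) :
    B (L (polarPoint 1 θ)) (M (angularVec (polarPoint r θ))) -
        B (L (angularVec (polarPoint r θ))) (M (polarPoint 1 θ)) =
      r • (B (L (frame 0)) (M (frame 1)) - B (L (frame 1)) (M (frame 0))) := by
  have a0 : (polarPoint 1 θ) 0 = Real.cos θ := by simp [polarPoint]
  have a1 : (polarPoint 1 θ) 1 = Real.sin θ := by simp [polarPoint]
  have b0 : (angularVec (polarPoint r θ)) 0 = -(r * Real.sin θ) := by
    simp [polarPoint, angularVec]
  have b1 : (angularVec (polarPoint r θ)) 1 = r * Real.cos θ := by simp [polarPoint, angularVec]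
  rw [map_eq_sum_frame L (polarPoint 1 θ), map_eq_sum_frame M (polarPoint 1 θ),
    map_eq_sum_frame L (angularVec _), map_eq_sum_frame M (angularVec _), a0, a1, b0, b1]
  simp only [map_add, map_smul, add_apply, smul_apply]
  have h : r = r * Real.cos θ ^ 2 + r * Real.sin θ ^ 2 := by
    linear_combination -r * Real.cos_sq_add_sin_sq θ
  conv_rhs => rw [h]
  module

theorem clamp_mem {a x : ℝ} (ha : 0 ≤ a) : max 0 (min x a) ∈ Icc 0 a :=
  ⟨le_max_left _ _, max_le ha (min_le_right _ _)⟩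

theorem clamp_eq {a x : ℝ} (hx : x ∈ Icc 0 a) : max 0 (min x a) = x := by
  rw [min_eq_left hx.2, max_eq_right hx.1]

theorem hasDerivAt_comp_polar_radial {f : Plane → E} {f' : Plane → Plane →L[ℝ] E}
    (hf : ∀ x ∈ halfBall, HasFDerivWithinAt f (f' x) halfBall x) {r θ : ℝ}
    (hr : r ∈ Ioo (0 : ℝ) 1) (hθ : θ ∈ Icc 0 Real.pi) :
    HasDerivAt (fun s => f (polarPoint s θ)) (f' (polarPoint r θ) (polarPoint 1 θ)) r := by
  have mem : ∀ s ∈ Ioo (0 : ℝ) 1, polarPoint s θ ∈ halfBall := fun s hs =>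
    halfDisc_subset_halfBall hs.2 (polarPoint_mem_halfDisc ⟨hs.1.le, le_rfl⟩ hθ)
  exact (hf _ (mem r hr)).comp_hasDerivAt r (hasDerivAt_polarPoint_radial r θ)
    (by filter_upwards [Ioo_mem_nhds hr.1 hr.2] with s hs using mem s hs)

/-- Unlike the radial case, the extreme angles are excluded: there the rays stay in the flat side,
but the circle leaves the half plane. -/
theorem hasDerivAt_comp_polar_angular {f : Plane → E} {f' : Plane → Plane →L[ℝ] E}
    (hf : ∀ x ∈ halfBall, HasFDerivWithinAt f (f' x) halfBall x) {r θ : ℝ}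
    (hr : r ∈ Ioo (0 : ℝ) 1) (hθ : θ ∈ Ioo 0 Real.pi) :
    HasDerivAt (fun s => f (polarPoint r s))
      (f' (polarPoint r θ) (angularVec (polarPoint r θ))) θ := by
  have mem : ∀ s ∈ Ioo 0 Real.pi, polarPoint r s ∈ halfBall := fun s hs =>
    halfDisc_subset_halfBall hr.2
      (polarPoint_mem_halfDisc ⟨hr.1.le, le_rfl⟩ (Ioo_subset_Icc_self hs))
  exact (hf _ (mem θ hθ)).comp_hasDerivAt θ (hasDerivAt_polarPoint_angular r θ)
    (by filter_upwards [Ioo_mem_nhds hθ.1 hθ.2] with s hs using mem s hs)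

theorem continuous_angularVec : Continuous angularVec := by
  unfold angularVec
  refine (PiLp.continuous_toLp 2 _).comp (continuous_pi fun i => ?_)
  fin_cases i <;> simp <;> fun_prop

/-- Green's theorem on a half disc for the 1-form `f dg`, with `f` and `g` of class `C¹` only. -/
theorem green_halfDisc [CompleteSpace G] (B : E →L[ℝ] F →L[ℝ] G) {t : ℝ} (ht0 : 0 < t) (ht : t < 1)
    {f : Plane → E} {f' : Plane → Plane →L[ℝ] E} {g : Plane → F} {g' : Plane → Plane →L[ℝ] F}
    (hf : ∀ x ∈ halfBall, HasFDerivWithinAt f (f' x) halfBall x) (cf' : ContinuousOn f' halfBall)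
    (hg : ∀ x ∈ halfBall, HasFDerivWithinAt g (g' x) halfBall x)
    (cg' : ContinuousOn g' halfBall) :
    arcIntegral t (fun x => ‖x‖⁻¹ • B (f x) (g' x (angularVec x))) +
        flatIntegral t (fun x => B (f x) (g' x (frame 0))) =
      ∫ x in halfDisc t,
        (B (f' x (frame 0)) (g' x (frame 1)) - B (f' x (frame 1)) (g' x (frame 0))) := by
  have hpi := Real.pi_pos
  have hsub := halfDisc_subset_halfBall ht
  have cf : ContinuousOn f halfBall := fun x hx => (hf x hx).continuousWithinAt
  have cg : ContinuousOn g halfBall := fun x hx => (hg x hx).continuousWithinAt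
  -- Clamping both polar coordinates makes every function continuous on the whole parameter plane,
  -- as the rectangle theorem demands, without changing it on the rectangle itself.
  set q : ℝ → ℝ → Plane := fun r θ => polarPoint (max 0 (min r t)) (max 0 (min θ Real.pi))
    with hq
  have cq : Continuous (Function.uncurry q) := by
    have : Continuous fun p : ℝ × ℝ => (max 0 (min p.1 t), max 0 (min p.2 Real.pi)) := by fun_prop
    exact continuous_polarPoint.comp this
  have mq : ∀ p : ℝ × ℝ, q p.1 p.2 ∈ halfBall := fun p =>
    hsub (polarPoint_mem_halfDisc (clamp_mem ht0.le) (clamp_mem hpi.le))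
  have qeq : ∀ {r θ}, r ∈ Icc 0 t → θ ∈ Icc 0 Real.pi → q r θ = polarPoint r θ := by
    intro r θ hr hθ; simp only [hq]; rw [clamp_eq hr, clamp_eq hθ]
  have ce : Continuous fun p : ℝ × ℝ => polarPoint 1 (max 0 (min p.2 Real.pi)) :=
    continuous_polarPoint.comp
      (by fun_prop : Continuous fun p : ℝ × ℝ => ((1 : ℝ), max 0 (min p.2 Real.pi)))
  have cc : Continuous fun p : ℝ × ℝ => angularVec (q p.1 p.2) := continuous_angularVec.comp cq
  have key := integral_bilin_rectangle B ht0.le hpi.le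
    (f := fun r θ => f (q r θ)) (g := fun r θ => g (q r θ))
    (f1 := fun r θ => f' (q r θ) (polarPoint 1 (max 0 (min θ Real.pi))))
    (g1 := fun r θ => g' (q r θ) (polarPoint 1 (max 0 (min θ Real.pi))))
    (f2 := fun r θ => f' (q r θ) (angularVec (q r θ)))
    (g2 := fun r θ => g' (q r θ) (angularVec (q r θ)))
    (cf.comp_continuous cq mq) ((cf'.comp_continuous cq mq).clm_apply ce)
    ((cf'.comp_continuous cq mq).clm_apply cc)
    (cg.comp_continuous cq mq) ((cg'.comp_continuous cq mq).clm_apply ce)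
    ((cg'.comp_continuous cq mq).clm_apply cc)
    (fun r hr θ hθ => by
      rw [qeq (Ioo_subset_Icc_self hr) hθ, clamp_eq hθ]
      refine (hasDerivAt_comp_polar_radial hf ⟨hr.1, hr.2.trans ht⟩ hθ).congr_of_eventuallyEq ?_
      filter_upwards [Ioo_mem_nhds hr.1 hr.2] with s hs
      rw [qeq (Ioo_subset_Icc_self hs) hθ])
    (fun r hr θ hθ => by
      rw [qeq (Ioo_subset_Icc_self hr) hθ, clamp_eq hθ]
      refine (hasDerivAt_comp_polar_radial hg ⟨hr.1, hr.2.trans ht⟩ hθ).congr_of_eventuallyEq ?_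
      filter_upwards [Ioo_mem_nhds hr.1 hr.2] with s hs
      rw [qeq (Ioo_subset_Icc_self hs) hθ])
    (fun r hr θ hθ => by
      rw [qeq (Ioo_subset_Icc_self hr) (Ioo_subset_Icc_self hθ)]
      refine (hasDerivAt_comp_polar_angular hf ⟨hr.1, hr.2.trans ht⟩ hθ).congr_of_eventuallyEq ?_
      filter_upwards [Ioo_mem_nhds hθ.1 hθ.2] with s hs
      rw [qeq (Ioo_subset_Icc_self hr) (Ioo_subset_Icc_self hs)])
    (fun r hr θ hθ => by
      rw [qeq (Ioo_subset_Icc_self hr) (Ioo_subset_Icc_self hθ)]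
      refine (hasDerivAt_comp_polar_angular hg ⟨hr.1, hr.2.trans ht⟩ hθ).congr_of_eventuallyEq ?_
      filter_upwards [Ioo_mem_nhds hθ.1 hθ.2] with s hs
      rw [qeq (Ioo_subset_Icc_self hr) (Ioo_subset_Icc_self hs)])
  have ht_mem : t ∈ Icc 0 t := ⟨ht0.le, le_rfl⟩
  have h0_mem : (0 : ℝ) ∈ Icc 0 t := ⟨le_rfl, ht0.le⟩
  have h0pi : (0 : ℝ) ∈ Icc 0 Real.pi := ⟨le_rfl, hpi.le⟩
  have hpipi : Real.pi ∈ Icc 0 Real.pi := ⟨hpi.le, le_rfl⟩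
  have arc : (∫ θ in (0 : ℝ)..Real.pi, B (f (q t θ)) (g' (q t θ) (angularVec (q t θ)))) =
      arcIntegral t (fun x => ‖x‖⁻¹ • B (f x) (g' x (angularVec x))) := by
    unfold arcIntegral
    refine intervalIntegral.integral_congr fun θ hθ => ?_
    rw [uIcc_of_le hpi.le] at hθ
    have e : (!₂[t * Real.cos θ, t * Real.sin θ] : Plane) = polarPoint t θ := rfl
    simp only [qeq ht_mem hθ, e]
    rw [norm_polarPoint, abs_of_pos ht0, smul_smul, mul_inv_cancel₀ ht0.ne', one_smul]
  -- The side `r = 0` of the rectangle collapses to the origin, where `∂_θ` vanishes.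
  have centre : (∫ θ in (0 : ℝ)..Real.pi, B (f (q 0 θ)) (g' (q 0 θ) (angularVec (q 0 θ)))) = 0 := by
    rw [intervalIntegral.integral_congr (g := fun _ => (0 : G)), intervalIntegral.integral_zero]
    intro θ hθ
    rw [uIcc_of_le hpi.le] at hθ
    have : angularVec (polarPoint 0 θ) = 0 := by
      ext i; fin_cases i <;> simp [angularVec, polarPoint]
    simp [qeq h0_mem hθ, this]
  have interior : (∫ r in (0 : ℝ)..t, ∫ θ in (0 : ℝ)..Real.pi,
      (B (f' (q r θ) (polarPoint 1 (max 0 (min θ Real.pi)))) (g' (q r θ) (angularVec (q r θ))) -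
        B (f' (q r θ) (angularVec (q r θ))) (g' (q r θ) (polarPoint 1 (max 0 (min θ Real.pi)))))) =
      ∫ x in halfDisc t,
        (B (f' x (frame 0)) (g' x (frame 1)) - B (f' x (frame 1)) (g' x (frame 0))) := by
    rw [integral_halfDisc_eq_polar ht0.le]
    · refine intervalIntegral.integral_congr fun r hr => intervalIntegral.integral_congr
        fun θ hθ => ?_
      rw [uIcc_of_le hpi.le] at hθ
      rw [uIcc_of_le ht0.le] at hr
      simp only [qeq hr hθ, clamp_eq hθ]
      exact bilin_polar_frame B _ _ r θ
    · have d1 : ∀ v, ContinuousOn (fun x => f' x v) (halfDisc t) := fun v =>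
        (cf'.mono hsub).clm_apply continuousOn_const
      have d2 : ∀ v, ContinuousOn (fun x => g' x v) (halfDisc t) := fun v =>
        (cg'.mono hsub).clm_apply continuousOn_const
      exact ((B.continuous.comp_continuousOn (d1 _)).clm_apply (d2 _)).sub
        ((B.continuous.comp_continuousOn (d1 _)).clm_apply (d2 _))
  have cflat : ContinuousOn (fun s : ℝ => B (f !₂[s, 0]) (g' !₂[s, 0] (frame 0))) (Icc (-t) t) := by
    have cl : Continuous fun s : ℝ => (!₂[s, 0] : Plane) := by
      refine (PiLp.continuous_toLp 2 _).comp (continuous_pi fun i => ?_)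
      fin_cases i <;> simp <;> fun_prop
    have ml : MapsTo (fun s : ℝ => (!₂[s, 0] : Plane)) (Icc (-t) t) halfBall := by
      intro s hs
      refine hsub ⟨?_, by simp⟩
      simpa [EuclideanSpace.norm_eq, Real.sqrt_sq_eq_abs] using abs_le.2 hs
    exact (B.continuous.comp_continuousOn (cf.comp cl.continuousOn ml)).clm_apply
      ((cg'.comp cl.continuousOn ml).clm_apply continuousOn_const)
  have right : (∫ r in (0 : ℝ)..t, B (f (q r 0))
      (g' (q r 0) (polarPoint 1 (max 0 (min 0 Real.pi))))) =
      ∫ s in (0 : ℝ)..t, B (f !₂[s, 0]) (g' !₂[s, 0] (frame 0)) := by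
    refine intervalIntegral.integral_congr fun r hr => ?_
    rw [uIcc_of_le ht0.le] at hr
    have e1 : polarPoint r 0 = !₂[r, 0] := by simp [polarPoint]
    have e2 : polarPoint 1 0 = frame 0 := by
      ext i; fin_cases i <;> simp [polarPoint, frame]
    simp only [qeq hr h0pi, clamp_eq h0pi, e1, e2]
  -- Along the ray `θ = π` the outward radial direction is `-e₁`; the substitution `s = -r` keeps
  -- the integrand's sign change and moves the integral to `[-t, 0]`.
  have left : (∫ r in (0 : ℝ)..t, B (f (q r Real.pi))
      (g' (q r Real.pi) (polarPoint 1 (max 0 (min Real.pi Real.pi))))) =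
      -∫ s in (-t)..0, B (f !₂[s, 0]) (g' !₂[s, 0] (frame 0)) := by
    have := intervalIntegral.integral_comp_neg (a := 0) (b := t)
      fun s : ℝ => B (f !₂[s, 0]) (g' !₂[s, 0] (frame 0))
    rw [neg_zero] at this
    rw [← this, ← intervalIntegral.integral_neg]
    refine intervalIntegral.integral_congr fun r hr => ?_
    rw [uIcc_of_le ht0.le] at hr
    have e1 : polarPoint r Real.pi = !₂[-r, 0] := by simp [polarPoint]
    have e2 : polarPoint 1 Real.pi = -frame 0 := by
      ext i; fin_cases i <;> simp [polarPoint, frame]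
    simp only [qeq hr hpipi, clamp_eq hpipi, e1, e2, map_neg]
  have split : flatIntegral t (fun x => B (f x) (g' x (frame 0))) =
      (∫ s in (-t)..0, B (f !₂[s, 0]) (g' !₂[s, 0] (frame 0))) +
        ∫ s in (0 : ℝ)..t, B (f !₂[s, 0]) (g' !₂[s, 0] (frame 0)) := by
    unfold flatIntegral
    rw [intervalIntegral.integral_add_adjacent_intervals]
    · exact (cflat.mono (Icc_subset_Icc le_rfl ht0.le)).intervalIntegrable_of_Icc (by linarith)
    · exact (cflat.mono (Icc_subset_Icc (by linarith) le_rfl)).intervalIntegrable_of_Icc ht0.le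
  rw [arc, centre, interior, right, left, sub_zero] at key
  rw [key, split]
  abel

theorem hasFDerivAt_coord (i : Fin 2) (x : Plane) :
    HasFDerivAt (fun y : Plane => y i) (EuclideanSpace.proj i : Plane →L[ℝ] ℝ) x :=
  (EuclideanSpace.proj i : Plane →L[ℝ] ℝ).hasFDerivAt

theorem arcIntegral_add {t : ℝ} {u v : Plane → E} (hu : ContinuousOn u (halfDisc t))
    (hv : ContinuousOn v (halfDisc t)) (ht : 0 ≤ t) :
    arcIntegral t (fun x => u x + v x) = arcIntegral t u + arcIntegral t v := by
  have c : ∀ {w : Plane → E}, ContinuousOn w (halfDisc t) →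
      IntervalIntegrable (fun θ => t • w !₂[t * Real.cos θ, t * Real.sin θ]) volume 0 Real.pi := by
    intro w hw
    refine ContinuousOn.intervalIntegrable_of_Icc Real.pi_pos.le (ContinuousOn.const_smul ?_ t)
    refine hw.comp (t := halfDisc t) ?_ fun θ hθ => polarPoint_mem_halfDisc ⟨ht, le_rfl⟩ hθ
    exact (continuous_polarPoint.comp
      (by fun_prop : Continuous fun θ : ℝ => (t, θ))).continuousOn
  unfold arcIntegral
  simp only [smul_add]
  exact intervalIntegral.integral_add (c hu) (c hv)

theorem arcIntegral_congr {t : ℝ} (ht : 0 ≤ t) {u v : Plane → E}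
    (h : ∀ x ∈ halfDisc t, ‖x‖ = t → u x = v x) : arcIntegral t u = arcIntegral t v := by
  refine intervalIntegral.integral_congr fun θ hθ => ?_
  rw [uIcc_of_le Real.pi_pos.le] at hθ
  have hm : polarPoint t θ ∈ halfDisc t := polarPoint_mem_halfDisc ⟨ht, le_rfl⟩ hθ
  have hn : ‖polarPoint t θ‖ = t := by rw [norm_polarPoint, abs_of_nonneg ht]
  exact congrArg (t • ·) (h _ hm hn)

theorem flatIntegral_congr {t : ℝ} (ht : 0 ≤ t) {u v : Plane → E}
    (h : ∀ x ∈ halfDisc t, x 1 = 0 → u x = v x) : flatIntegral t u = flatIntegral t v := by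
  refine intervalIntegral.integral_congr fun s hs => h _ ⟨?_, by simp⟩ (by simp)
  rw [uIcc_of_le (by linarith)] at hs
  simpa [EuclideanSpace.norm_eq, Real.sqrt_sq_eq_abs] using abs_le.2 hs

/-- The divergence theorem on a half disc. -/
theorem divergence_halfDisc {t : ℝ} (ht0 : 0 < t) (ht : t < 1)
    {V W : Plane → ℝ} {V' W' : Plane → Plane →L[ℝ] ℝ}
    (hV : ∀ x ∈ halfBall, HasFDerivWithinAt V (V' x) halfBall x) (cV' : ContinuousOn V' halfBall)
    (hW : ∀ x ∈ halfBall, HasFDerivWithinAt W (W' x) halfBall x)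
    (cW' : ContinuousOn W' halfBall) :
    arcIntegral t (fun x => t⁻¹ * (V x * x 0 + W x * x 1)) - flatIntegral t W =
      ∫ x in halfDisc t, (V' x (frame 0) + W' x (frame 1)) := by
  have hsub := halfDisc_subset_halfBall ht
  have cV : ContinuousOn V (halfDisc t) := fun x hx => ((hV x (hsub hx)).continuousWithinAt).mono hsub
  have cW : ContinuousOn W (halfDisc t) := fun x hx => ((hW x (hsub hx)).continuousWithinAt).mono hsub
  -- The flux form is `V dx² - W dx¹`: Green's theorem is used with `g` a coordinate function, whose
  -- value on `∂_θ` is `x¹` for `dx²` and `-x²` for `dx¹`.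
  have g1 := green_halfDisc (ContinuousLinearMap.mul ℝ ℝ) ht0 ht hV cV'
    (g' := fun _ => (EuclideanSpace.proj 1 : Plane →L[ℝ] ℝ))
    (fun x _ => (hasFDerivAt_coord 1 x).hasFDerivWithinAt) continuousOn_const
  have g2 := green_halfDisc (ContinuousLinearMap.mul ℝ ℝ) ht0 ht hW cW'
    (g' := fun _ => (EuclideanSpace.proj 0 : Plane →L[ℝ] ℝ))
    (fun x _ => (hasFDerivAt_coord 0 x).hasFDerivWithinAt) continuousOn_const
  have p00 : (frame 0) 0 = 1 := by simp [frame]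
  have p01 : (frame 0) 1 = 0 := by simp [frame]
  have p10 : (frame 1) 0 = 0 := by simp [frame]
  have p11 : (frame 1) 1 = 1 := by simp [frame]
  have a0 : ∀ x, (angularVec x) 0 = -x 1 := fun x => by simp [angularVec]
  have a1 : ∀ x, (angularVec x) 1 = x 0 := fun x => by simp [angularVec]
  simp only [ContinuousLinearMap.mul_apply', PiLp.proj_apply, p00, p01, p10, p11, a0, a1, mul_one,
    mul_zero, sub_zero, zero_sub] at g1 g2
  have z : flatIntegral t (fun _ : Plane => (0 : ℝ)) = 0 := by simp [flatIntegral]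
  rw [z, add_zero] at g1
  have e1 : arcIntegral t (fun x => ‖x‖⁻¹ • (V x * x 0)) =
      arcIntegral t (fun x => t⁻¹ * (V x * x 0)) :=
    arcIntegral_congr ht0.le fun x _ hx => by rw [hx, smul_eq_mul]
  have e2 : arcIntegral t (fun x => ‖x‖⁻¹ • (W x * -x 1)) =
      -arcIntegral t (fun x => t⁻¹ * (W x * x 1)) := by
    rw [arcIntegral_congr (v := fun x => -(t⁻¹ * (W x * x 1))) ht0.le
      fun x _ hx => by rw [hx, smul_eq_mul]; ring]
    simp [arcIntegral]
  rw [e1] at g1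
  rw [e2] at g2
  have i1 : IntegrableOn (fun x => V' x (frame 0)) (halfDisc t) :=
    ((cV'.mono hsub).clm_apply continuousOn_const).integrableOn_compact (isCompact_halfDisc t)
  have i2 : IntegrableOn (fun x => W' x (frame 1)) (halfDisc t) :=
    ((cW'.mono hsub).clm_apply continuousOn_const).integrableOn_compact (isCompact_halfDisc t)
  rw [integral_neg] at g2
  rw [integral_add i1 i2, ← g1]
  have cc : ∀ i, ContinuousOn (fun x : Plane => x i) (halfDisc t) := fun i =>
    Continuous.continuousOn (by fun_prop)
  have : arcIntegral t (fun x => t⁻¹ * (V x * x 0 + W x * x 1)) =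
      arcIntegral t (fun x => t⁻¹ * (V x * x 0)) + arcIntegral t (fun x => t⁻¹ * (W x * x 1)) := by
    rw [← arcIntegral_add (u := fun x => t⁻¹ * (V x * x 0)) (v := fun x => t⁻¹ * (W x * x 1))
      (continuousOn_const.mul (cV.mul (cc 0)))
      (continuousOn_const.mul (cW.mul (cc 1))) ht0.le]
    simp only [mul_add]
  rw [this]
  linarith

end Green

/-! ### Tangent spaces of a submanifold and differentiability of the tangent projection. -/

section Submanifold

open Filter Topology Set

section Projection

variable {V E : Type*} [NormedAddCommGroup V] [InnerProductSpace ℝ V] [FiniteDimensional ℝ V]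
  [NormedAddCommGroup E] [InnerProductSpace ℝ E] [FiniteDimensional ℝ E]

/-- Since `⟨T*Tv, v⟩ = |Tv|²`, the kernel is trivial, and in finite dimension this suffices. -/
theorem isUnit_adjoint_comp_self {T : V →L[ℝ] E} (hT : Function.Injective T) :
    IsUnit (T.adjoint ∘L T : V →L[ℝ] V) := by
  have hinj : Function.Injective (T.adjoint ∘L T : V →L[ℝ] V) := by
    rw [injective_iff_map_eq_zero]
    intro v hv
    refine (injective_iff_map_eq_zero T).1 hT v ?_
    have : inner ℝ (T v) (T v) = 0 := by
      rw [← ContinuousLinearMap.adjoint_inner_right]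
      have hv' : T.adjoint (T v) = 0 := hv
      rw [hv', inner_zero_right]
    exact inner_self_eq_zero.1 this
  rw [ContinuousLinearMap.isUnit_iff_bijective]
  exact ⟨hinj, (LinearMap.injective_iff_surjective
    (f := ((T.adjoint ∘L T : V →L[ℝ] V) : V →ₗ[ℝ] V))).1 hinj⟩

/-- The orthogonal projection onto the range of an injective map `T` is `T (T* T)⁻¹ T*`. -/
theorem starProjection_range_eq {T : V →L[ℝ] E} (hT : Function.Injective T)
    (S : Submodule ℝ E) (hS : ∀ y, y ∈ S ↔ ∃ v, T v = y) :
    T ∘L Ring.inverse (T.adjoint ∘L T : V →L[ℝ] V) ∘L T.adjoint = S.starProjection := by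
  ext1 y
  symm
  have hu := isUnit_adjoint_comp_self hT
  refine Submodule.eq_starProjection_of_mem_orthogonal' ((hS _).2 ⟨_, rfl⟩)
    (z := y - T (Ring.inverse (T.adjoint ∘L T : V →L[ℝ] V) (T.adjoint y))) ?_ ?_
  · rw [Submodule.mem_orthogonal]
    intro z hz
    obtain ⟨v, rfl⟩ := (hS z).1 hz
    have h1 : (T.adjoint ∘L T : V →L[ℝ] V)
        (Ring.inverse (T.adjoint ∘L T : V →L[ℝ] V) (T.adjoint y)) = T.adjoint y := by
      have := Ring.mul_inverse_cancel _ hu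
      exact congrArg (fun L : V →L[ℝ] V => L (T.adjoint y)) this
    rw [← ContinuousLinearMap.adjoint_inner_right, map_sub]
    have h2 : T.adjoint (T (Ring.inverse (T.adjoint ∘L T : V →L[ℝ] V) (T.adjoint y))) =
      T.adjoint y := h1
    rw [h2, sub_self, inner_zero_right]
  · simp

theorem isBoundedLinearMap_adjoint :
    IsBoundedLinearMap ℝ (fun T : V →L[ℝ] E => T.adjoint) where
  map_add := fun S T => by simp
  map_smul := fun c T => by simp
  bound := ⟨1, one_pos, fun T => by simp⟩

/-- The explicit formula `T (T*T)⁻¹ T*` turns differentiability of a moving frame into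
differentiability of the projection onto its span, inversion being differentiable at units. -/
theorem differentiableAt_projection {X : Type*} [NormedAddCommGroup X] [NormedSpace ℝ X]
    {T : X → V →L[ℝ] E} {p : X} (hT : DifferentiableAt ℝ T p) (hinj : Function.Injective (T p)) :
    DifferentiableAt ℝ (fun q => T q ∘L Ring.inverse ((T q).adjoint ∘L T q : V →L[ℝ] V) ∘L
      (T q).adjoint) p := by
  have h1 : DifferentiableAt ℝ (fun q => (T q).adjoint) p :=
    (isBoundedLinearMap_adjoint.differentiable.differentiableAt).comp p hT
  have h2 : DifferentiableAt ℝ (fun q => ((T q).adjoint ∘L T q : V →L[ℝ] V)) p := h1.clm_comp hT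
  have h3 : DifferentiableAt ℝ (fun q => Ring.inverse ((T q).adjoint ∘L T q : V →L[ℝ] V)) p :=
    DifferentiableAt.comp p (g := Ring.inverse) 
      (differentiableAt_inverse (isUnit_adjoint_comp_self hinj)) h2
  exact hT.clm_comp (h3.clm_comp h1)

end Projection

variable {K n : ℕ} {N : Set (Ambient K)}

theorem tangentProj_apply_of_mem {p X : Ambient K} (hX : X ∈ tangentSpaceAt N p) :
    tangentProj N p X = X :=
  Submodule.starProjection_eq_self_iff.2 hX

theorem tangentProj_mem (p X : Ambient K) : tangentProj N p X ∈ tangentSpaceAt N p :=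
  Submodule.starProjection_apply_mem _ _

theorem tangentProj_tangentProj (p X : Ambient K) :
    tangentProj N p (tangentProj N p X) = tangentProj N p X :=
  tangentProj_apply_of_mem (tangentProj_mem p X)

theorem inner_tangentProj_left (p X Y : Ambient K) :
    inner ℝ (tangentProj N p X) Y = inner ℝ X (tangentProj N p Y) :=
  Submodule.inner_starProjection_left_eq_right _ _ _

section Chart

variable {e : OpenPartialHomeomorph (Ambient K) (Ambient K)} {V : Submodule ℝ (Ambient K)}

theorem contDiffAt_chart (he : ContDiffOn ℝ ∞ e e.source) {q : Ambient K} (hq : q ∈ e.source) :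
    ContDiffAt ℝ ∞ e q :=
  he.contDiffAt (e.open_source.mem_nhds hq)

theorem contDiffAt_chart_symm (he : ContDiffOn ℝ ∞ e.symm e.target) {y : Ambient K}
    (hy : y ∈ e.target) : ContDiffAt ℝ ∞ e.symm y :=
  he.contDiffAt (e.open_target.mem_nhds hy)

theorem fderiv_symm_fderiv_chart (he : ContDiffOn ℝ ∞ e e.source)
    (he' : ContDiffOn ℝ ∞ e.symm e.target) {q : Ambient K} (hq : q ∈ e.source) (X : Ambient K) :
    fderiv ℝ e.symm (e q) (fderiv ℝ e q X) = X := by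
  have h1 := ((contDiffAt_chart he hq).differentiableAt (by simp)).hasFDerivAt
  have h2 := ((contDiffAt_chart_symm he' (e.map_source hq)).differentiableAt (by simp)).hasFDerivAt
  have h3 : HasFDerivAt (e.symm ∘ e) (ContinuousLinearMap.id ℝ _) q :=
    (hasFDerivAt_id q).congr_of_eventuallyEq (e.eventually_left_inverse hq)
  exact congrArg (fun L : Ambient K →L[ℝ] Ambient K => L X) ((h2.comp q h1).unique h3)

theorem fderiv_fderiv_symm_chart (he : ContDiffOn ℝ ∞ e e.source)
    (he' : ContDiffOn ℝ ∞ e.symm e.target) {q : Ambient K} (hq : q ∈ e.source) (X : Ambient K) :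
    fderiv ℝ e q (fderiv ℝ e.symm (e q) X) = X := by
  have h := fderiv_symm_fderiv_chart (e := e.symm) he' (by simpa using he) (e.map_source hq) X
  simpa [e.left_inv hq] using h

/-- The component of `e` orthogonal to `V` vanishes on `N` near `q`, so its derivative kills
tangent-cone directions. Conversely `V` contains the segments in its own directions, and `e.symm`
carries those directions to the tangent cone of `N`; in particular that cone is already linear. -/
theorem mem_tangentSpaceAt_iff_chart (he : ContDiffOn ℝ ∞ e e.source)
    (he' : ContDiffOn ℝ ∞ e.symm e.target) (hV : ∀ q ∈ e.source, (q ∈ N ↔ e q ∈ V))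
    {q : Ambient K} (hq : q ∈ e.source) (hqN : q ∈ N) (X : Ambient K) :
    X ∈ tangentSpaceAt N q ↔ ∃ v : V, fderiv ℝ e.symm (e q) v = X := by
  constructor
  · intro hX
    suffices h : tangentSpaceAt N q ≤ V.comap (fderiv ℝ e q : Ambient K →ₗ[ℝ] Ambient K) from
      ⟨⟨fderiv ℝ e q X, h hX⟩, fderiv_symm_fderiv_chart he he' hq X⟩
    refine Submodule.span_le.2 fun Y hY => ?_
    have h1 := ((contDiffAt_chart he hq).differentiableAt (by simp)).hasFDerivAt
    have h2 : HasFDerivWithinAt (fun z => Vᗮ.starProjection (e z))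
        (Vᗮ.starProjection ∘L fderiv ℝ e q) N q :=
      (Vᗮ.starProjection.hasFDerivAt.comp q h1).hasFDerivWithinAt
    have hzero : ∀ z ∈ V, Vᗮ.starProjection z = 0 := fun z hz => by
      rw [Submodule.starProjection_orthogonal_val, Submodule.starProjection_eq_self_iff.2 hz,
        sub_self]
    have h3 : HasFDerivWithinAt (fun z => Vᗮ.starProjection (e z))
        (0 : Ambient K →L[ℝ] Ambient K) N q := by
      refine (hasFDerivWithinAt_const (0 : Ambient K) q N).congr_of_eventuallyEq ?_ ?_
      · filter_upwards [self_mem_nhdsWithin,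
          nhdsWithin_le_nhds (e.open_source.mem_nhds hq)] with z hz hzs
        exact hzero _ ((hV z hzs).1 hz)
      · exact hzero _ ((hV q hq).1 hqN)
    have h4 : Vᗮ.starProjection (fderiv ℝ e q Y) = 0 := by
      have h5 := h2.unique_on h3 hY
      rwa [ContinuousLinearMap.comp_apply, zero_apply] at h5
    rw [Submodule.starProjection_orthogonal_val, sub_eq_zero] at h4
    have h6 : fderiv ℝ e q Y ∈ V := Submodule.starProjection_eq_self_iff.1 h4.symm
    exact h6
  · rintro ⟨v, rfl⟩
    refine Submodule.subset_span ?_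
    have hqV := (hV q hq).1 hqN
    have h0 : (v : Ambient K) ∈ tangentConeAt ℝ ((V : Set (Ambient K)) ∩ e.target) (e q) := by
      rw [tangentConeAt_inter_nhds (e.open_target.mem_nhds (e.map_source hq))]
      have := mem_tangentConeAt_of_segment_subset (s := (V : Set (Ambient K))) (x := e q)
        (y := e q + v) (V.convex.segment_subset hqV (V.add_mem hqV v.2))
      simpa using this
    have h2 := ((contDiffAt_chart_symm he' (e.map_source hq)).differentiableAt
      (by simp)).hasFDerivAt.hasFDerivWithinAt (s := (V : Set (Ambient K)) ∩ e.target)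
    have h3 := h2.mapsTo_tangent_cone h0
    rw [e.left_inv hq] at h3
    refine tangentConeAt_mono ?_ h3
    rintro _ ⟨y, ⟨hyV, hyt⟩, rfl⟩
    rw [hV _ (e.map_target hyt), e.right_inv hyt]
    exact hyV

end Chart

theorem two_le_smooth : (2 : WithTop ℕ∞) ≤ ∞ :=
  WithTop.coe_le_coe.2 (le_top : (2 : ℕ∞) ≤ ⊤)

/-- Near each of its points the tangent projection of a submanifold extends differentiably to the
ambient space; its derivative is symmetric in tangent directions. -/
theorem exists_extension_tangentProj (hN : IsSmoothSubmanifold n N) {p : Ambient K} (hp : p ∈ N) :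
    ∃ (G : Ambient K → Ambient K →L[ℝ] Ambient K)
      (G' : Ambient K →L[ℝ] Ambient K →L[ℝ] Ambient K),
      HasFDerivAt G G' p ∧ (∀ᶠ q in 𝓝[N] p, G q = tangentProj N q) ∧
      ∀ X ∈ tangentSpaceAt N p, ∀ Y ∈ tangentSpaceAt N p, G' X Y = G' Y X := by
  obtain ⟨e, V, hps, he, he', -, hV⟩ := hN p hp
  set T : Ambient K → V →L[ℝ] Ambient K := fun q => fderiv ℝ e.symm (e q) ∘L V.subtypeL with hT
  set G : Ambient K → Ambient K →L[ℝ] Ambient K := fun q =>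
    T q ∘L Ring.inverse ((T q).adjoint ∘L T q : V →L[ℝ] V) ∘L (T q).adjoint with hG
  have hinj : ∀ q ∈ e.source, Function.Injective (T q) := by
    intro q hq v w hvw
    have := congrArg (fderiv ℝ e q) hvw
    simp only [hT, ContinuousLinearMap.comp_apply, Submodule.subtypeL_apply,
      fderiv_fderiv_symm_chart he he' hq] at this
    exact Subtype.ext this
  have hGeq : ∀ q ∈ e.source, q ∈ N → G q = tangentProj N q := fun q hq hqN =>
    starProjection_range_eq (hinj q hq) _ fun y =>
      mem_tangentSpaceAt_iff_chart he he' hV hq hqN y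
  have hF := contDiffAt_chart_symm he' (e.map_source hps)
  have hdF : DifferentiableAt ℝ (fderiv ℝ e.symm) (e p) :=
    (hF.fderiv_right (m := 1) (by rw [one_add_one_eq_two]; exact two_le_smooth)).differentiableAt (by simp)
  have hTd : DifferentiableAt ℝ T p := by
    have := hdF.comp p ((contDiffAt_chart he hps).differentiableAt (by simp))
    exact this.clm_comp (differentiableAt_const _)
  have hGd : HasFDerivAt G (fderiv ℝ G p) p :=
    (differentiableAt_projection hTd (hinj p hps)).hasFDerivAt
  refine ⟨G, fderiv ℝ G p, hGd, ?_, ?_⟩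
  · filter_upwards [self_mem_nhdsWithin,
      nhdsWithin_le_nhds (e.open_source.mem_nhds hps)] with q hqN hqs using hGeq q hqs hqN
  -- With `F = e.symm`, the vectors `DF(y)w` are tangent at `F(y)` for `y ∈ V`, so `G(F(y)) DF(y)w =
  -- DF(y)w`. Differentiating along `u` expresses `G'` on tangent vectors through `D²F`, which is
  -- symmetric.
  · have key : ∀ u w : V, fderiv ℝ G p (fderiv ℝ e.symm (e p) u) (fderiv ℝ e.symm (e p) w) +
        G p (fderiv ℝ (fderiv ℝ e.symm) (e p) u w) =
          fderiv ℝ (fderiv ℝ e.symm) (e p) u w := by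
      intro u w
      have hc : HasDerivAt (fun s : ℝ => e p + s • (u : Ambient K)) (u : Ambient K) 0 := by
        simpa using ((hasDerivAt_id (0 : ℝ)).smul_const (u : Ambient K)).const_add (e p)
      have hc0 : e p + (0 : ℝ) • (u : Ambient K) = e p := by simp
      have hF1 : HasDerivAt (fun s : ℝ => e.symm (e p + s • (u : Ambient K)))
          (fderiv ℝ e.symm (e p) u) 0 := by
        exact (hF.differentiableAt (by simp)).hasFDerivAt.comp_hasDerivAt_of_eq (0 : ℝ) hc hc0.symm
      have hF2 : HasDerivAt (fun s : ℝ => fderiv ℝ e.symm (e p + s • (u : Ambient K)))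
          (fderiv ℝ (fderiv ℝ e.symm) (e p) u) 0 := by
        exact hdF.hasFDerivAt.comp_hasDerivAt_of_eq (0 : ℝ) hc hc0.symm
      have hF3 : HasDerivAt (fun s : ℝ => fderiv ℝ e.symm (e p + s • (u : Ambient K)) w)
          (fderiv ℝ (fderiv ℝ e.symm) (e p) u w) 0 := by
        simpa using hF2.clm_apply (hasDerivAt_const (0 : ℝ) (w : Ambient K))
      have hG1 : HasDerivAt (fun s : ℝ => G (e.symm (e p + s • (u : Ambient K))))
          (fderiv ℝ G p (fderiv ℝ e.symm (e p) u)) 0 := by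
        exact hGd.comp_hasDerivAt_of_eq (0 : ℝ) hF1 (by rw [hc0, e.left_inv hps])
      have hG2 := hG1.clm_apply hF3
      simp only [hc0, e.left_inv hps] at hG2
      refine hG2.unique (hF3.congr_of_eventuallyEq ?_)
      have hmem : ∀ᶠ s : ℝ in 𝓝 0, e p + s • (u : Ambient K) ∈ e.target := by
        refine hc.continuousAt.eventually_mem ?_
        rw [hc0]
        exact e.open_target.mem_nhds (e.map_source hps)
      filter_upwards [hmem] with s hs
      have hyV : e p + s • (u : Ambient K) ∈ V :=
        V.add_mem ((hV p hps).1 hp) (V.smul_mem s u.2)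
      have hsrc := e.map_target hs
      have hyN : e.symm (e p + s • (u : Ambient K)) ∈ N := by
        rw [hV _ hsrc, e.right_inv hs]; exact hyV
      rw [hGeq _ hsrc hyN]
      refine tangentProj_apply_of_mem
        ((mem_tangentSpaceAt_iff_chart he he' hV hsrc hyN _).2 ⟨w, ?_⟩)
      rw [e.right_inv hs]
    have hsymm : IsSymmSndFDerivAt ℝ e.symm (e p) :=
      hF.isSymmSndFDerivAt (by simpa using two_le_smooth)
    intro X hX Y hY
    obtain ⟨u, rfl⟩ := (mem_tangentSpaceAt_iff_chart he he' hV hps hp X).1 hX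
    obtain ⟨w, rfl⟩ := (mem_tangentSpaceAt_iff_chart he he' hV hps hp Y).1 hY
    have h1 := key u w
    have h2 := key w u
    rw [hsymm.eq] at h2
    exact add_right_cancel (h1.trans h2.symm)

end Submanifold

/-! ### Pointwise algebra of `A`, Clifford multiplication and coefficient endomorphisms. -/

section Pointwise

open Filter Topology Set

variable {K n : ℕ} {N : Set (Ambient K)}

/-! ### The second fundamental form -/

theorem tangentProj_secondFF (p X Y : Ambient K) : tangentProj N p (secondFF N p X Y) = 0 := by
  simp [secondFF, tangentProj_tangentProj]

/-- Differentiating `Π² = Π` gives `Π'Π + ΠΠ' = Π'`, hence `(1 - Π)Π' = Π'Π` in tangent directions.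
Thus the normal projection in the definition of `A` becomes a tangential projection of the second
argument. Derivatives within `N` are determined only on the span of the tangent cone, which is where
they are compared. -/
theorem exists_secondFF_eq (hN : IsSmoothSubmanifold n N) {p : Ambient K} (hp : p ∈ N) :
    ∃ (G : Ambient K → Ambient K →L[ℝ] Ambient K)
      (G' : Ambient K →L[ℝ] Ambient K →L[ℝ] Ambient K),
      HasFDerivAt G G' p ∧ (∀ᶠ q in 𝓝[N] p, G q = tangentProj N q) ∧
      (∀ X ∈ tangentSpaceAt N p, ∀ Y ∈ tangentSpaceAt N p, G' X Y = G' Y X) ∧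
      ∀ X Y, secondFF N p X Y = -G' (tangentProj N p X) (tangentProj N p Y) := by
  obtain ⟨G, G', hG, hGeq, hsymm⟩ := exists_extension_tangentProj hN hp
  refine ⟨G, G', hG, hGeq, hsymm, fun X Y => ?_⟩
  have hGp : G p = tangentProj N p := hGeq.self_of_nhdsWithin hp
  have hP : HasFDerivWithinAt (tangentProj N) G' N p :=
    hG.hasFDerivWithinAt.congr_of_eventuallyEq (hGeq.mono fun _ h => h.symm) hGp.symm
  have hcone : ∀ {L M : Ambient K →L[ℝ] Ambient K →L[ℝ] Ambient K},
      EqOn L M (tangentConeAt ℝ N p) → ∀ Z ∈ tangentSpaceAt N p, L Z = M Z := by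
    intro L M h Z hZ
    exact LinearMap.eqOn_span (f := L.toLinearMap) (g := M.toLinearMap) (fun z hz => h hz) hZ
  have h1 : fderivWithin ℝ (tangentProj N) N p (tangentProj N p X) = G' (tangentProj N p X) :=
    hcone (hP.differentiableWithinAt.hasFDerivWithinAt.unique_on hP) _ (tangentProj_mem p X)
  have hsq : HasFDerivWithinAt (fun q => tangentProj N q ∘L tangentProj N q) G' N p := by
    refine hP.congr_of_eventuallyEq (Eventually.of_forall fun q => ?_) ?_
    · ext1 Z; exact tangentProj_tangentProj q Z
    · ext1 Z; exact tangentProj_tangentProj p Z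
  have h2 := hcone ((hP.clm_comp hP).unique_on hsq) _ (tangentProj_mem p X)
  have h3 := congrArg (fun L : Ambient K →L[ℝ] Ambient K => L Y) h2
  simp only [add_apply, ContinuousLinearMap.comp_apply, ContinuousLinearMap.compL_apply,
    ContinuousLinearMap.flip_apply] at h3
  simp only [secondFF, neg_apply, sub_apply, ContinuousLinearMap.comp_apply,
    ContinuousLinearMap.id_apply, h1]
  rw [sub_eq_of_eq_add' h3.symm]

theorem secondFF_symm (hN : IsSmoothSubmanifold n N) {p : Ambient K} (hp : p ∈ N)
    (X Y : Ambient K) : secondFF N p X Y = secondFF N p Y X := by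
  obtain ⟨G, G', -, -, hsymm, hA⟩ := exists_secondFF_eq hN hp
  rw [hA, hA, hsymm _ (tangentProj_mem p X) _ (tangentProj_mem p Y)]

theorem secondFF_add_smul (p X Y : Ambient K) (a b : ℝ) :
    secondFF N p (a • X + b • Y) = a • secondFF N p X + b • secondFF N p Y := by
  ext1 Z
  simp [secondFF]
  module

/-- The definition as an adjoint yields `A(X, Y)`; symmetry puts `Y` into the first slot, where `A`
combines linearly over the partial derivatives of `φ`. -/
theorem inner_shapeOp (hN : IsSmoothSubmanifold n N) {p : Ambient K} (hp : p ∈ N)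
    (ξ X Y : Ambient K) : inner ℝ Y (shapeOp N p ξ X) = inner ℝ (secondFF N p Y X) ξ := by
  rw [shapeOp, ContinuousLinearMap.adjoint_inner_right, secondFF_symm hN hp]

/-! ### Clifford multiplication and coefficient endomorphisms -/

theorem clifford_apply_zero (v : Plane) (ψ : TwistedSpinor K) (k : Fin K) :
    clifford v ψ k 0 = ((v 0 : ℂ) + Complex.I * (v 1 : ℂ)) * ψ k 1 := by
  simp [clifford, spinorAct, cliffordMatrix, dotProduct, Fin.sum_univ_two]
  ring_nf
  simp

theorem clifford_apply_one (v : Plane) (ψ : TwistedSpinor K) (k : Fin K) :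
    clifford v ψ k 1 = (-(v 0 : ℂ) + Complex.I * (v 1 : ℂ)) * ψ k 0 := by
  simp [clifford, spinorAct, cliffordMatrix, dotProduct, Fin.sum_univ_two]
  ring_nf
  simp

theorem twistedSpinor_ext {ψ η : TwistedSpinor K} (h0 : ∀ k, ψ k 0 = η k 0)
    (h1 : ∀ k, ψ k 1 = η k 1) : ψ = η := by
  ext k i
  fin_cases i
  · exact h0 k
  · exact h1 k

theorem clifford_add_left (v w : Plane) (ψ : TwistedSpinor K) :
    clifford (v + w) ψ = clifford v ψ + clifford w ψ := by
  refine twistedSpinor_ext (fun k => ?_) fun k => ?_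
  · simp [clifford_apply_zero]; ring
  · simp [clifford_apply_one]; ring

theorem clifford_smul_left (c : ℝ) (v : Plane) (ψ : TwistedSpinor K) :
    clifford (c • v) ψ = c • clifford v ψ := by
  refine twistedSpinor_ext (fun k => ?_) fun k => ?_
  · simp [clifford_apply_zero]; ring
  · simp [clifford_apply_one]; ring

theorem clifford_add_right (v : Plane) (ψ η : TwistedSpinor K) :
    clifford v (ψ + η) = clifford v ψ + clifford v η := by
  refine twistedSpinor_ext (fun k => ?_) fun k => ?_
  · simp [clifford_apply_zero]; ring
  · simp [clifford_apply_one]; ring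

theorem clifford_smul_right (c : ℝ) (v : Plane) (ψ : TwistedSpinor K) :
    clifford v (c • ψ) = c • clifford v ψ := by
  refine twistedSpinor_ext (fun k => ?_) fun k => ?_
  · simp [clifford_apply_zero]; ring
  · simp [clifford_apply_one]; ring

/-- Clifford multiplication as a continuous bilinear map. -/
noncomputable def cliffordBilin (K : ℕ) : Plane →L[ℝ] TwistedSpinor K →L[ℝ] TwistedSpinor K :=
  (LinearMap.mk₂ ℝ clifford clifford_add_left clifford_smul_left clifford_add_right
    clifford_smul_right).toContinuousBilinearMap

@[simp]
theorem cliffordBilin_apply (v : Plane) (ψ : TwistedSpinor K) :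
    cliffordBilin K v ψ = clifford v ψ := rfl

theorem inner_clifford_left (v : Plane) (ψ η : TwistedSpinor K) :
    inner ℂ (clifford v ψ) η = -inner ℂ ψ (clifford v η) := by
  simp only [PiLp.inner_apply, Fin.sum_univ_two, clifford_apply_zero, clifford_apply_one,
    ← Finset.sum_neg_distrib]
  refine Finset.sum_congr rfl fun k _ => ?_
  simp
  ring

theorem idTensor_apply (L : Ambient K →L[ℝ] Ambient K) (ψ : TwistedSpinor K) (k : Fin K)
    (i : Fin 2) :
    idTensor L ψ k i = ∑ j, ((L (EuclideanSpace.single j 1) k : ℝ) : ℂ) * ψ j i := by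
  simp [idTensor]

theorem idTensor_add_left (L M : Ambient K →L[ℝ] Ambient K) (ψ : TwistedSpinor K) :
    idTensor (L + M) ψ = idTensor L ψ + idTensor M ψ := by
  ext k i; simp [idTensor_apply, add_mul, Finset.sum_add_distrib]

theorem idTensor_smul_left (c : ℝ) (L : Ambient K →L[ℝ] Ambient K) (ψ : TwistedSpinor K) :
    idTensor (c • L) ψ = c • idTensor L ψ := by
  ext k i; simp [idTensor_apply, Finset.mul_sum, mul_assoc]

theorem idTensor_add_right (L : Ambient K →L[ℝ] Ambient K) (ψ η : TwistedSpinor K) :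
    idTensor L (ψ + η) = idTensor L ψ + idTensor L η := by
  ext k i; simp [idTensor_apply, mul_add, Finset.sum_add_distrib]

theorem idTensor_smul_right (c : ℝ) (L : Ambient K →L[ℝ] Ambient K) (ψ : TwistedSpinor K) :
    idTensor L (c • ψ) = c • idTensor L ψ := by
  ext k i; simp [idTensor_apply, Finset.mul_sum, mul_left_comm]

/-- `(L, ψ) ↦ (id ⊗ L) ψ` as a continuous bilinear map. -/
noncomputable def idTensorBilin (K : ℕ) :
    (Ambient K →L[ℝ] Ambient K) →L[ℝ] TwistedSpinor K →L[ℝ] TwistedSpinor K :=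
  (LinearMap.mk₂ ℝ idTensor idTensor_add_left idTensor_smul_left idTensor_add_right
    idTensor_smul_right).toContinuousBilinearMap

@[simp]
theorem idTensorBilin_apply (L : Ambient K →L[ℝ] Ambient K) (ψ : TwistedSpinor K) :
    idTensorBilin K L ψ = idTensor L ψ := rfl

theorem map_eq_sum_single (L : Ambient K →L[ℝ] Ambient K) (y : Ambient K) (k : Fin K) :
    L y k = ∑ j, y j * L (EuclideanSpace.single j 1) k := by
  have : y = ∑ j, y j • EuclideanSpace.single j (1 : ℝ) := by
    ext i; simp [Finset.sum_apply, Pi.single_apply]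
  conv_lhs => rw [this]
  simp

theorem idTensor_comp (L M : Ambient K →L[ℝ] Ambient K) (ψ : TwistedSpinor K) :
    idTensor (L ∘L M) ψ = idTensor L (idTensor M ψ) := by
  ext k i
  simp only [idTensor_apply, ContinuousLinearMap.comp_apply, Finset.mul_sum]
  rw [Finset.sum_comm]
  refine Finset.sum_congr rfl fun j _ => ?_
  rw [map_eq_sum_single L (M _) k]
  push_cast
  rw [Finset.sum_mul]
  exact Finset.sum_congr rfl fun l _ => by ring

theorem idTensor_clifford (L : Ambient K →L[ℝ] Ambient K) (v : Plane) (ψ : TwistedSpinor K) :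
    idTensor L (clifford v ψ) = clifford v (idTensor L ψ) := by
  refine twistedSpinor_ext (fun k => ?_) fun k => ?_
  · simp only [idTensor_apply, clifford_apply_zero, Finset.mul_sum]
    exact Finset.sum_congr rfl fun j _ => by ring
  · simp only [idTensor_apply, clifford_apply_one, Finset.mul_sum]
    exact Finset.sum_congr rfl fun j _ => by ring

theorem idTensor_zero_left (ψ : TwistedSpinor K) : idTensor 0 ψ = 0 := by
  ext k i; simp [idTensor_apply]

theorem inner_idTensor_idTensor (L M : Ambient K →L[ℝ] Ambient K) (ψ η : TwistedSpinor K) :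
    inner ℂ (idTensor L ψ) (idTensor M η) =
      ∑ i, ∑ j, ((inner ℝ (L (EuclideanSpace.single i 1)) (M (EuclideanSpace.single j 1)) : ℝ) : ℂ)
        * inner ℂ (ψ i) (η j) := by
  simp only [PiLp.inner_apply, idTensor_apply, RCLike.inner_apply, map_sum, map_mul,
    Complex.conj_ofReal, Complex.ofReal_sum, conj_trivial, Complex.ofReal_mul, Finset.sum_mul,
    Finset.mul_sum, Fin.sum_univ_two, mul_add, Finset.sum_add_distrib]
  congr 1
  all_goals
    rw [Finset.sum_comm]
    refine Finset.sum_congr rfl fun i _ => ?_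
    rw [Finset.sum_comm]
    exact Finset.sum_congr rfl fun j _ => Finset.sum_congr rfl fun k _ => by ring

/-- Recognises the double sum defining the spinorial force as one Hermitian product of spinors of
the form `(id ⊗ A)ψ`. -/
theorem re_inner_idTensor_idTensor (L M : Ambient K →L[ℝ] Ambient K) (ψ η : TwistedSpinor K) :
    (inner ℂ (idTensor L ψ) (idTensor M η)).re =
      ∑ i, ∑ j, (inner ℂ (ψ i) (η j)).re *
        inner ℝ (L (EuclideanSpace.single i 1)) (M (EuclideanSpace.single j 1)) := by
  rw [inner_idTensor_idTensor]
  simp [Complex.re_sum, mul_comm]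

/-- The matrix of an orthogonal projection is real and symmetric, so its complexified action on `ℂ²
⊗ ℝᴷ` remains self-adjoint. -/
theorem inner_idTensor_tangentProj (p : Ambient K) (ψ η : TwistedSpinor K) :
    inner ℂ (idTensor (tangentProj N p) ψ) η = inner ℂ ψ (idTensor (tangentProj N p) η) := by
  have hsymm : ∀ j k : Fin K, tangentProj N p (EuclideanSpace.single j 1) k =
      tangentProj N p (EuclideanSpace.single k 1) j := by
    intro j k
    have := inner_tangentProj_left (N := N) p (EuclideanSpace.single j 1)
      (EuclideanSpace.single k 1)
    simpa [EuclideanSpace.inner_single_left, EuclideanSpace.inner_single_right] using this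
  simp only [PiLp.inner_apply, idTensor_apply, RCLike.inner_apply, map_sum, map_mul,
    Complex.conj_ofReal, Finset.sum_mul, Finset.mul_sum, Fin.sum_univ_two, Finset.sum_add_distrib]
  congr 1
  all_goals
    rw [Finset.sum_comm]
    refine Finset.sum_congr rfl fun i _ => Finset.sum_congr rfl fun j _ => ?_
    rw [hsymm]
    ring

end Pointwise

/-! ### Sections along `φ`: the normal part of the derivative and the curvature identity. -/

section SpinorPointwise

open Filter Topology Set

variable {K n : ℕ} {N : Set (Ambient K)} {Ω : Set Plane}

theorem span_tangentConeAt_eq_top {x : Plane} (hu : UniqueDiffWithinAt ℝ Ω x) :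
    Submodule.span ℝ (tangentConeAt ℝ Ω x) = ⊤ := by
  have h := Submodule.dense_iff_topologicalClosure_eq_top.1 hu.dense_tangentConeAt
  rwa [IsClosed.submodule_topologicalClosure_eq (Submodule.closed_of_finiteDimensional _)] at h

/-- The derivative maps the tangent cone of `Ω` into that of `N`, and unique differentiability makes
the former span the plane, so boundary points are covered too. -/
theorem fderivWithin_mem_tangentSpaceAt {φ : Plane → Ambient K} {φ' : Plane →L[ℝ] Ambient K}
    {x : Plane} (hu : UniqueDiffWithinAt ℝ Ω x) (hφ : HasFDerivWithinAt φ φ' Ω x)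
    (hmaps : MapsTo φ Ω N) (v : Plane) : φ' v ∈ tangentSpaceAt N (φ x) := by
  have h : Submodule.span ℝ (tangentConeAt ℝ Ω x) ≤
      (tangentSpaceAt N (φ x)).comap φ'.toLinearMap := by
    refine Submodule.span_le.2 fun w hw => Submodule.subset_span ?_
    exact tangentConeAt_mono hmaps.image_subset (hφ.mapsTo_tangent_cone hw)
  rw [span_tangentConeAt_eq_top hu] at h
  exact h (Submodule.mem_top (x := v))

/-- The normal part of the derivative of a section along `φ`. -/
theorem fderivWithin_section_eq (hN : IsSmoothSubmanifold n N)
    {φ : Plane → Ambient K} {φ' : Plane →L[ℝ] Ambient K} {ψ : Plane → TwistedSpinor K}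
    {ψ' : Plane →L[ℝ] TwistedSpinor K} {x : Plane} (hx : x ∈ Ω)
    (hu : UniqueDiffWithinAt ℝ Ω x) (hφ : HasFDerivWithinAt φ φ' Ω x)
    (hψ : HasFDerivWithinAt ψ ψ' Ω x) (hmaps : MapsTo φ Ω N) (hsec : IsSectionAlong N Ω φ ψ)
    (v : Plane) :
    ψ' v = idTensor (tangentProj N (φ x)) (ψ' v)
      - idTensor (secondFF N (φ x) (φ' v)) (ψ x) := by
  obtain ⟨G, G', hG, hGeq, -, hA⟩ := exists_secondFF_eq hN (hmaps hx)
  have hGφ : HasFDerivWithinAt (fun y => G (φ y)) (G' ∘L φ') Ω x := hG.comp_hasFDerivWithinAt x hφ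
  -- Both sides of `Π_φ ψ = ψ` are differentiated, with `Π` replaced by its ambient extension `G`;
  -- the term in which `G` is differentiated is the normal part.
  have h1 := (idTensorBilin K).hasFDerivWithinAt_of_bilinear hGφ hψ
  have hev : ∀ᶠ y in 𝓝[Ω] x, G (φ y) = tangentProj N (φ y) :=
    (tendsto_nhdsWithin_iff.2 ⟨hφ.continuousWithinAt.tendsto,
      eventually_mem_nhdsWithin.mono fun y hy => hmaps hy⟩).eventually hGeq
  have hGx : G (φ x) = tangentProj N (φ x) := hev.self_of_nhdsWithin hx
  have h2 : HasFDerivWithinAt (fun y => idTensorBilin K (G (φ y)) (ψ y)) ψ' Ω x := by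
    refine hψ.congr_of_eventuallyEq ?_ ?_
    · filter_upwards [hev, self_mem_nhdsWithin] with y hy hyΩ
      rw [hy, idTensorBilin_apply, hsec y hyΩ]
    · rw [hGx, idTensorBilin_apply, hsec x hx]
  have h3 := congrArg (fun L : Plane →L[ℝ] TwistedSpinor K => L v) (hu.eq h1 h2)
  simp only [add_apply, ContinuousLinearMap.precompR_apply, ContinuousLinearMap.precompL_apply,
    ContinuousLinearMap.comp_apply, idTensorBilin_apply, hGx] at h3
  have h4 : idTensor (G' (φ' v)) (ψ x) = -idTensor (secondFF N (φ x) (φ' v)) (ψ x) := by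
    have e : secondFF N (φ x) (φ' v) = (-1 : ℝ) • (G' (φ' v) ∘L tangentProj N (φ x)) := by
      ext1 Y
      rw [hA, tangentProj_apply_of_mem (fderivWithin_mem_tangentSpaceAt hu hφ hmaps v)]
      simp
    rw [e, idTensor_smul_left, idTensor_comp, hsec x hx]
    simp
  rw [h4] at h3
  rw [← sub_eq_add_neg] at h3
  exact h3.symm

theorem idTensor_tangentProj_secondFF (p X : Ambient K) (ψ : TwistedSpinor K) :
    idTensor (tangentProj N p) (idTensor (secondFF N p X) ψ) = 0 := by
  rw [← idTensor_comp]
  have : tangentProj N p ∘L secondFF N p X = 0 := by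
    ext1 Y; exact tangentProj_secondFF p X Y
  rw [this, idTensor_zero_left]

theorem re_inner_comm (ψ η : TwistedSpinor K) : (inner ℂ ψ η).re = (inner ℂ η ψ).re :=
  inner_re_symm (𝕜 := ℂ) _ _

theorem re_inner_clifford_self (v : Plane) (ψ : TwistedSpinor K) :
    (inner ℂ (clifford v ψ) ψ).re = 0 := by
  have h1 := congrArg Complex.re (inner_clifford_left v ψ ψ)
  rw [Complex.neg_re, re_inner_comm ψ] at h1
  linarith

theorem inner_clifford_frame (x : Plane) (ψ η : TwistedSpinor K) :
    inner ℂ ψ (clifford (angularVec x) η) =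
      (x 0 : ℂ) * inner ℂ ψ (clifford (frame 1) η) -
        (x 1 : ℂ) * inner ℂ ψ (clifford (frame 0) η) := by
  have : angularVec x = x 0 • frame 1 + (-x 1) • frame 0 := by
    ext i; fin_cases i <;> simp [angularVec, frame]
  rw [this, clifford_add_left, clifford_smul_left, clifford_smul_left, inner_add_right,
    inner_smul_right_eq_smul, inner_smul_right_eq_smul]
  simp
  ring

/-- With `X = x¹∂₁ + x²∂₂`: `Re⟨∑ e_α·β_α, β_X⟩ = Re⟨β₁, ∂_θ·β₂⟩`. -/
theorem re_inner_clifford_sum (x : Plane) (a b : TwistedSpinor K) :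
    (inner ℂ (clifford (frame 0) a + clifford (frame 1) b) (x 0 • a + x 1 • b)).re =
      (inner ℂ a (clifford (angularVec x) b)).re := by
  -- The diagonal terms `Re⟨e_α·β, β⟩` vanish by skew-adjointness, and the two mixed terms assemble
  -- into Clifford multiplication by `∂_θ`.
  rw [inner_clifford_frame]
  simp only [inner_add_left, inner_add_right, inner_smul_right_eq_smul, Complex.add_re,
    Complex.real_smul, Complex.re_ofReal_mul, Complex.sub_re, re_inner_clifford_self]
  rw [re_inner_comm _ a, inner_clifford_left, Complex.neg_re]
  ring

theorem re_inner_sum_clifford (x : Plane) (a b : TwistedSpinor K) :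
    (inner ℂ (x 0 • a + x 1 • b) (clifford (frame 0) a)).re +
      (inner ℂ (x 0 • a + x 1 • b) (clifford (frame 1) b)).re =
      (inner ℂ a (clifford (angularVec x) b)).re := by
  rw [← re_inner_clifford_sum, re_inner_comm, re_inner_comm _ (clifford (frame 1) b),
    inner_add_left, Complex.add_re]

variable {φ : Plane → Ambient K} {ψ : Plane → TwistedSpinor K} {x : Plane}

/-- The spinorial force tested against the conformal field `X = x¹∂₁ + x²∂₂`. -/
theorem inner_spinorShapeTerm (hN : IsSmoothSubmanifold n N) (hp : φ x ∈ N) :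
    inner ℝ (fderivWithin ℝ φ Ω x x) (spinorShapeTerm N Ω φ ψ x) =
      (inner ℂ (idTensor (secondFF N (φ x) (partialDeriv Ω φ 0 x)) (ψ x))
        (clifford (angularVec x)
          (idTensor (secondFF N (φ x) (partialDeriv Ω φ 1 x)) (ψ x)))).re := by
  -- By linearity `A(rφ_r)ψ` is the combination `x¹β₁ + x²β₂` of `β_α = A(φ_α)ψ`, so the algebraic
  -- identity used for the tangential part applies to the normal part as well.
  have hX : secondFF N (φ x) (fderivWithin ℝ φ Ω x x) =
      x 0 • secondFF N (φ x) (partialDeriv Ω φ 0 x) +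
        x 1 • secondFF N (φ x) (partialDeriv Ω φ 1 x) := by
    rw [map_eq_sum_frame (fderivWithin ℝ φ Ω x) x, secondFF_add_smul]; rfl
  rw [← re_inner_sum_clifford, ← idTensor_smul_left, ← idTensor_smul_left, ← idTensor_add_left,
    ← hX, ← idTensor_clifford, ← idTensor_clifford, re_inner_idTensor_idTensor,
    re_inner_idTensor_idTensor]
  simp only [spinorShapeTerm, inner_sum, inner_add_right, inner_smul_right, inner_shapeOp hN hp,
    Fin.sum_univ_two]

theorem inner_secondFFTerm (hmem : ∀ v, fderivWithin ℝ φ Ω x v ∈ tangentSpaceAt N (φ x))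
    (v : Plane) : inner ℝ (fderivWithin ℝ φ Ω x v) (secondFFTerm N Ω φ x) = 0 := by
  rw [secondFFTerm, inner_sum]
  refine Finset.sum_eq_zero fun α _ => ?_
  rw [← tangentProj_apply_of_mem (hmem v), inner_tangentProj_left, tangentProj_secondFF,
    inner_zero_right]

theorem norm_smul_radialVec (x : Plane) : ‖x‖ • radialVec x = x := by
  by_cases hx : x = 0
  · simp [hx]
  · rw [radialVec, smul_smul, mul_inv_cancel₀ (norm_ne_zero_iff.2 hx), one_smul]

/-- Removes the polar singularity: `r∂_r` is differentiation along the position vector, also at the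
origin, where both sides vanish. -/
theorem norm_smul_radialDeriv {F : Type*} [NormedAddCommGroup F] [NormedSpace ℝ F]
    (f : Plane → F) (x : Plane) : ‖x‖ • radialDeriv Ω f x = fderivWithin ℝ f Ω x x := by
  rw [radialDeriv, ← map_smul, norm_smul_radialVec]

theorem covDeriv_smul (c : ℝ) (x v : Plane) :
    covDeriv N Ω φ ψ x (c • v) = c • covDeriv N Ω φ ψ x v := by
  simp only [covDeriv, map_smul, idTensor_smul_right]

theorem norm_smul_covDeriv_radialVec (x : Plane) :
    ‖x‖ • covDeriv N Ω φ ψ x (radialVec x) = covDeriv N Ω φ ψ x x := by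
  rw [← covDeriv_smul, norm_smul_radialVec]

/-- `ψ` is tangential, and Clifford multiplication commutes with the self-adjoint projection, so the
normal part of the derivative does not contribute. -/
theorem inner_clifford_covDeriv (hsec : IsSectionAlong N Ω φ ψ) (hx : x ∈ Ω) (v w : Plane) :
    inner ℂ (ψ x) (clifford v (covDeriv N Ω φ ψ x w)) =
      inner ℂ (ψ x) (clifford v (fderivWithin ℝ ψ Ω x w)) := by
  rw [covDeriv, ← idTensor_clifford, ← inner_idTensor_tangentProj, hsec x hx]

theorem inner_diracAlong (hsec : IsSectionAlong N Ω φ ψ) (hx : x ∈ Ω) :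
    inner ℂ (ψ x) (diracAlong N Ω φ ψ x) =
      inner ℂ (ψ x) (clifford (frame 0) (fderivWithin ℝ ψ Ω x (frame 0))) +
        inner ℂ (ψ x) (clifford (frame 1) (fderivWithin ℝ ψ Ω x (frame 1))) := by
  rw [diracAlong, Fin.sum_univ_two, inner_add_right, inner_clifford_covDeriv hsec hx,
    inner_clifford_covDeriv hsec hx]

theorem idTensor_tangentProj_covDeriv (x v : Plane) :
    idTensor (tangentProj N (φ x)) (covDeriv N Ω φ ψ x v) = covDeriv N Ω φ ψ x v := by
  rw [covDeriv, ← idTensor_comp]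
  congr 1
  ext1 Y; exact tangentProj_tangentProj _ Y

/-- The Dirac term is tangential. Passing to the plain derivative, which is continuous, makes
integrability of this product accessible. -/
theorem inner_diracAlong_covDeriv (v : Plane) :
    inner ℂ (diracAlong N Ω φ ψ x) (covDeriv N Ω φ ψ x v) =
      inner ℂ (diracAlong N Ω φ ψ x) (fderivWithin ℝ ψ Ω x v) := by
  have h : idTensor (tangentProj N (φ x)) (diracAlong N Ω φ ψ x) = diracAlong N Ω φ ψ x := by
    rw [diracAlong, Fin.sum_univ_two, idTensor_add_right, idTensor_clifford, idTensor_clifford,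
      idTensor_tangentProj_covDeriv, idTensor_tangentProj_covDeriv]
  rw [covDeriv, ← inner_idTensor_tangentProj, h]

/-- The exterior derivative of `⟨ψ, ∂_θ·dψ⟩` in terms of the Dirac operator and the curvature. -/
theorem re_inner_fderivWithin_angular (hN : IsSmoothSubmanifold n N) (hx : x ∈ Ω)
    (hu : UniqueDiffWithinAt ℝ Ω x) (hφ : DifferentiableWithinAt ℝ φ Ω x)
    (hψ : DifferentiableWithinAt ℝ ψ Ω x) (hmaps : MapsTo φ Ω N)
    (hsec : IsSectionAlong N Ω φ ψ) :
    (inner ℂ (fderivWithin ℝ ψ Ω x (frame 0))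
        (clifford (angularVec x) (fderivWithin ℝ ψ Ω x (frame 1)))).re =
      (inner ℂ (diracAlong N Ω φ ψ x) (‖x‖ • covDeriv N Ω φ ψ x (radialVec x))).re +
        inner ℝ (fderivWithin ℝ φ Ω x x) (spinorShapeTerm N Ω φ ψ x) := by
  have hdec := fderivWithin_section_eq hN hx hu hφ.hasFDerivWithinAt hψ.hasFDerivWithinAt hmaps hsec
  have hcov : covDeriv N Ω φ ψ x x =
      x 0 • covDeriv N Ω φ ψ x (frame 0) + x 1 • covDeriv N Ω φ ψ x (frame 1) := by
    simp only [covDeriv]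
    rw [map_eq_sum_frame (fderivWithin ℝ ψ Ω x) x, idTensor_add_right, idTensor_smul_right,
      idTensor_smul_right]
  rw [norm_smul_covDeriv_radialVec, hcov, diracAlong, Fin.sum_univ_two, re_inner_clifford_sum,
    inner_spinorShapeTerm hN (hmaps hx), hdec (frame 0), hdec (frame 1)]
  change (inner ℂ (covDeriv N Ω φ ψ x (frame 0) -
    idTensor (secondFF N (φ x) (partialDeriv Ω φ 0 x)) (ψ x)) (clifford (angularVec x)
      (covDeriv N Ω φ ψ x (frame 1) -
        idTensor (secondFF N (φ x) (partialDeriv Ω φ 1 x)) (ψ x)))).re = _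
  -- Clifford multiplication acts on the other tensor factor, so tangential and normal spinors stay
  -- orthogonal after it.
  have hcross1 : ∀ v w Y, inner ℂ (covDeriv N Ω φ ψ x v)
      (clifford w (idTensor (secondFF N (φ x) Y) (ψ x))) = 0 := by
    intro v w Y
    rw [← idTensor_tangentProj_covDeriv, inner_idTensor_tangentProj, idTensor_clifford,
      idTensor_tangentProj_secondFF, ← cliffordBilin_apply, map_zero, inner_zero_right]
  have hcross2 : ∀ v w Y, inner ℂ (idTensor (secondFF N (φ x) Y) (ψ x))
      (clifford w (covDeriv N Ω φ ψ x v)) = 0 := by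
    intro v w Y
    rw [← idTensor_tangentProj_covDeriv, ← idTensor_clifford, ← inner_idTensor_tangentProj,
      idTensor_tangentProj_secondFF, inner_zero_left]
  rw [← cliffordBilin_apply, map_sub, inner_sub_left, inner_sub_right, inner_sub_right]
  simp only [cliffordBilin_apply, hcross1, hcross2]
  simp

end SpinorPointwise

/-! ### Derivatives within `Ω` up to the flat boundary. -/

section Regularity

open Filter Topology Set

variable {F : Type*} [NormedAddCommGroup F] [NormedSpace ℝ F] {Ω : Set Plane}

theorem uniqueDiffWithinAt_of_mem_halfBall (hDΩ : halfDisc 1 ⊆ Ω) (hΩ : Ω ⊆ halfPlane) {x : Plane}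
    (hx : x ∈ halfBall) : UniqueDiffWithinAt ℝ Ω x :=
  (uniqueDiffWithinAt_congr (nhdsWithin_eq_halfBall hDΩ hΩ hx)).2 (uniqueDiffOn_halfBall x hx)

theorem fderivWithin_eq_halfBall (hDΩ : halfDisc 1 ⊆ Ω) (hΩ : Ω ⊆ halfPlane) (f : Plane → F)
    {x : Plane} (hx : x ∈ halfBall) : fderivWithin ℝ f Ω x = fderivWithin ℝ f halfBall x :=
  fderivWithin_congr_set (nhdsWithin_eq_iff_eventuallyEq.1 (nhdsWithin_eq_halfBall hDΩ hΩ hx))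

theorem contDiffOn_fderivWithin_halfBall (hDΩ : halfDisc 1 ⊆ Ω) (hΩ : Ω ⊆ halfPlane)
    {f : Plane → F} {m k : WithTop ℕ∞} (hf : ContDiffOn ℝ k f halfBall) (hmk : m + 1 ≤ k) :
    ContDiffOn ℝ m (fderivWithin ℝ f Ω) halfBall :=
  (hf.fderivWithin uniqueDiffOn_halfBall hmk).congr fun _ hx =>
    fderivWithin_eq_halfBall hDΩ hΩ f hx

theorem continuousOn_fderivWithin_halfBall (hDΩ : halfDisc 1 ⊆ Ω) (hΩ : Ω ⊆ halfPlane)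
    {f : Plane → F} (hf : ContDiffOn ℝ 1 f halfBall) :
    ContinuousOn (fderivWithin ℝ f Ω) halfBall :=
  (contDiffOn_fderivWithin_halfBall hDΩ hΩ (m := 0) hf (by simp)).continuousOn

theorem hasFDerivWithinAt_halfBall (hDΩ : halfDisc 1 ⊆ Ω) (hΩ : Ω ⊆ halfPlane)
    {f : Plane → F} (hf : ContDiffOn ℝ 1 f halfBall) {x : Plane} (hx : x ∈ halfBall) :
    HasFDerivWithinAt f (fderivWithin ℝ f Ω x) halfBall x := by
  rw [fderivWithin_eq_halfBall hDΩ hΩ f hx]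
  exact (hf.differentiableOn (by simp) x hx).hasFDerivWithinAt

theorem fderivWithin_eq_of_hasFDerivWithinAt_halfBall (hDΩ : halfDisc 1 ⊆ Ω) (hΩ : Ω ⊆ halfPlane)
    {f : Plane → F} {f' : Plane →L[ℝ] F} {x : Plane} (hx : x ∈ halfBall)
    (hf : HasFDerivWithinAt f f' halfBall x) : fderivWithin ℝ f Ω x = f' := by
  rw [fderivWithin_eq_halfBall hDΩ hΩ f hx]
  exact hf.fderivWithin (uniqueDiffOn_halfBall x hx)

theorem one_add_one_le_two : (1 + 1 : WithTop ℕ∞) ≤ 2 := by rw [one_add_one_eq_two]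

/-- The second derivative within `Ω`. -/
noncomputable abbrev secondDeriv (Ω : Set Plane) (f : Plane → F) (x : Plane) :
    Plane →L[ℝ] Plane →L[ℝ] F :=
  fderivWithin ℝ (fderivWithin ℝ f Ω) Ω x

theorem hasFDerivWithinAt_fderivWithin (hDΩ : halfDisc 1 ⊆ Ω) (hΩ : Ω ⊆ halfPlane)
    {f : Plane → F} (hf : ContDiffOn ℝ 2 f halfBall) {x : Plane} (hx : x ∈ halfBall) :
    HasFDerivWithinAt (fderivWithin ℝ f Ω) (secondDeriv Ω f x) halfBall x :=
  hasFDerivWithinAt_halfBall hDΩ hΩ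
    (contDiffOn_fderivWithin_halfBall hDΩ hΩ hf one_add_one_le_two) hx

/-- Symmetry persists at flat boundary points because the half ball, being convex with interior,
lies in the closure of its interior. -/
theorem secondDeriv_symm (hDΩ : halfDisc 1 ⊆ Ω) (hΩ : Ω ⊆ halfPlane)
    {f : Plane → F} (hf : ContDiffOn ℝ 2 f halfBall) {x : Plane} (hx : x ∈ halfBall)
    (v w : Plane) : secondDeriv Ω f x v w = secondDeriv Ω f x w v := by
  have e : secondDeriv Ω f x = fderivWithin ℝ (fderivWithin ℝ f halfBall) halfBall x := by
    rw [secondDeriv, fderivWithin_eq_halfBall hDΩ hΩ _ hx]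
    exact fderivWithin_congr (fun y hy => fderivWithin_eq_halfBall hDΩ hΩ f hy)
      (fderivWithin_eq_halfBall hDΩ hΩ f hx)
  rw [e]
  refine (ContDiffWithinAt.isSymmSndFDerivWithinAt (hf x hx) (by simp) uniqueDiffOn_halfBall
    ?_ hx).eq v w
  rw [convex_halfBall.closure_interior_eq_closure_of_nonempty_interior nonempty_interior_halfBall]
  exact subset_closure hx

theorem hasFDerivWithinAt_partialDeriv (hDΩ : halfDisc 1 ⊆ Ω) (hΩ : Ω ⊆ halfPlane)
    {f : Plane → F} (hf : ContDiffOn ℝ 2 f halfBall) {x : Plane} (hx : x ∈ halfBall) (α : Fin 2) :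
    HasFDerivWithinAt (partialDeriv Ω f α) ((secondDeriv Ω f x).flip (frame α)) halfBall x := by
  have := (hasFDerivWithinAt_fderivWithin hDΩ hΩ hf hx).clm_apply
    (hasFDerivWithinAt_const (frame α) x halfBall)
  refine this.congr_fderiv ?_
  ext v; simp

theorem fderivWithin_partialDeriv (hDΩ : halfDisc 1 ⊆ Ω) (hΩ : Ω ⊆ halfPlane)
    {f : Plane → F} (hf : ContDiffOn ℝ 2 f halfBall) {x : Plane} (hx : x ∈ halfBall) (α : Fin 2)
    (v : Plane) : fderivWithin ℝ (partialDeriv Ω f α) Ω x v = secondDeriv Ω f x v (frame α) := by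
  rw [fderivWithin_eq_of_hasFDerivWithinAt_halfBall hDΩ hΩ hx
    (hasFDerivWithinAt_partialDeriv hDΩ hΩ hf hx α)]
  rfl

theorem laplacian_eq (hDΩ : halfDisc 1 ⊆ Ω) (hΩ : Ω ⊆ halfPlane)
    {f : Plane → F} (hf : ContDiffOn ℝ 2 f halfBall) {x : Plane} (hx : x ∈ halfBall) :
    laplacian Ω f x = ∑ α, secondDeriv Ω f x (frame α) (frame α) :=
  Finset.sum_congr rfl fun α _ => fderivWithin_partialDeriv hDΩ hΩ hf hx α (frame α)

theorem contDiffOn_partialDeriv (hDΩ : halfDisc 1 ⊆ Ω) (hΩ : Ω ⊆ halfPlane)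
    {f : Plane → F} (hf : ContDiffOn ℝ 2 f halfBall) (α : Fin 2) :
    ContDiffOn ℝ 1 (partialDeriv Ω f α) halfBall :=
  (contDiffOn_fderivWithin_halfBall hDΩ hΩ hf one_add_one_le_two).clm_apply contDiffOn_const

theorem continuousOn_secondDeriv (hDΩ : halfDisc 1 ⊆ Ω) (hΩ : Ω ⊆ halfPlane)
    {f : Plane → F} (hf : ContDiffOn ℝ 2 f halfBall) :
    ContinuousOn (secondDeriv Ω f) halfBall :=
  continuousOn_fderivWithin_halfBall hDΩ hΩ
    (contDiffOn_fderivWithin_halfBall hDΩ hΩ hf one_add_one_le_two)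

theorem continuousOn_laplacian (hDΩ : halfDisc 1 ⊆ Ω) (hΩ : Ω ⊆ halfPlane)
    {f : Plane → F} (hf : ContDiffOn ℝ 2 f halfBall) : ContinuousOn (laplacian Ω f) halfBall := by
  refine ContinuousOn.congr (f := fun x => ∑ α, secondDeriv Ω f x (frame α) (frame α)) ?_
    fun x hx => laplacian_eq hDΩ hΩ hf hx
  exact continuousOn_finsetSum _ fun α _ => ((continuousOn_secondDeriv hDΩ hΩ hf).clm_apply
    continuousOn_const).clm_apply continuousOn_const

end Regularity

/-! ### Pohozaev identity for the map component. -/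

section MapPart

open Filter Topology Set

variable {K : ℕ} {Ω : Set Plane}

theorem contDiffOn_conformalDeriv (hDΩ : halfDisc 1 ⊆ Ω) (hΩ : Ω ⊆ halfPlane)
    {u : Plane → Ambient K} (hu : ContDiffOn ℝ 2 u halfBall) :
    ContDiffOn ℝ 1 (fun x => fderivWithin ℝ u Ω x x) halfBall :=
  (contDiffOn_fderivWithin_halfBall hDΩ hΩ hu one_add_one_le_two).clm_apply contDiffOn_id

/-- The density `∑ ⟨∂_αφ, ∂_αu + r∂_r(∂_αu)⟩`. -/
noncomputable def dilationDensity (Ω : Set Plane) (φ u : Plane → Ambient K) (x : Plane) : ℝ :=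
  ∑ α, inner ℝ (partialDeriv Ω φ α x)
    (partialDeriv Ω u α x + ‖x‖ • radialDeriv Ω (partialDeriv Ω u α) x)

/-- The rewritten density contains no unit radial vector, so it is visibly continuous across the
origin. -/
theorem dilationDensity_eq (hDΩ : halfDisc 1 ⊆ Ω) (hΩ : Ω ⊆ halfPlane)
    {φ u : Plane → Ambient K} (hu : ContDiffOn ℝ 2 u halfBall) {x : Plane} (hx : x ∈ halfBall) :
    dilationDensity Ω φ u x = ∑ α, inner ℝ (partialDeriv Ω φ α x)
      (partialDeriv Ω u α x + secondDeriv Ω u x x (frame α)) := by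
  refine Finset.sum_congr rfl fun α _ => ?_
  rw [norm_smul_radialDeriv, fderivWithin_partialDeriv hDΩ hΩ hu hx]

theorem continuousOn_dilationDensity (hDΩ : halfDisc 1 ⊆ Ω) (hΩ : Ω ⊆ halfPlane)
    {φ u : Plane → Ambient K} (hφ : ContDiffOn ℝ 2 φ halfBall) (hu : ContDiffOn ℝ 2 u halfBall) :
    ContinuousOn (dilationDensity Ω φ u) halfBall := by
  refine ContinuousOn.congr ?_ fun x hx => dilationDensity_eq hDΩ hΩ (φ := φ) hu hx
  exact continuousOn_finsetSum _ fun α _ =>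
    (contDiffOn_partialDeriv hDΩ hΩ hφ α).continuousOn.inner
      ((contDiffOn_partialDeriv hDΩ hΩ hu α).continuousOn.add
        (((continuousOn_secondDeriv hDΩ hΩ hu).clm_apply continuousOn_id).clm_apply
          continuousOn_const))

/-- The divergence theorem for the vector field `⟨r u_r, ∂_αφ⟩`. -/
theorem integral_inner_laplacian (hDΩ : halfDisc 1 ⊆ Ω) (hΩ : Ω ⊆ halfPlane)
    {φ u : Plane → Ambient K} (hφ : ContDiffOn ℝ 2 φ halfBall) (hu : ContDiffOn ℝ 2 u halfBall)
    {t : ℝ} (ht0 : 0 < t) (ht : t < 1) :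
    arcIntegral t (fun x => ‖x‖ * inner ℝ (radialDeriv Ω φ x) (radialDeriv Ω u x)) -
        flatIntegral t (fun x => inner ℝ (fderivWithin ℝ u Ω x x) (partialDeriv Ω φ 1 x)) =
      (∫ x in halfDisc t, inner ℝ (fderivWithin ℝ u Ω x x) (laplacian Ω φ x)) +
        ∫ x in halfDisc t, dilationDensity Ω φ u x := by
  have hsub := halfDisc_subset_halfBall ht
  have cW : ∀ α, ContDiffOn ℝ 1
      (fun x => inner ℝ (fderivWithin ℝ u Ω x x) (partialDeriv Ω φ α x)) halfBall := fun α =>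
    (contDiffOn_conformalDeriv hDΩ hΩ hu).inner ℝ (contDiffOn_partialDeriv hDΩ hΩ hφ α)
  have hdiv := divergence_halfDisc ht0 ht
    (fun x hx => hasFDerivWithinAt_halfBall hDΩ hΩ (cW 0) hx)
    (continuousOn_fderivWithin_halfBall hDΩ hΩ (cW 0))
    (fun x hx => hasFDerivWithinAt_halfBall hDΩ hΩ (cW 1) hx)
    (continuousOn_fderivWithin_halfBall hDΩ hΩ (cW 1))
  have harc : arcIntegral t (fun x => t⁻¹ *
      (inner ℝ (fderivWithin ℝ u Ω x x) (partialDeriv Ω φ 0 x) * x 0 +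
        inner ℝ (fderivWithin ℝ u Ω x x) (partialDeriv Ω φ 1 x) * x 1)) =
      arcIntegral t (fun x => ‖x‖ * inner ℝ (radialDeriv Ω φ x) (radialDeriv Ω u x)) := by
    refine arcIntegral_congr ht0.le fun x _ hx => ?_
    have h1 : inner ℝ (fderivWithin ℝ u Ω x x) (partialDeriv Ω φ 0 x) * x 0 +
        inner ℝ (fderivWithin ℝ u Ω x x) (partialDeriv Ω φ 1 x) * x 1 =
        inner ℝ (fderivWithin ℝ u Ω x x) (fderivWithin ℝ φ Ω x x) := by
      rw [map_eq_sum_frame (fderivWithin ℝ φ Ω x) x, inner_add_right, inner_smul_right,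
        inner_smul_right]
      simp only [partialDeriv]
      ring
    rw [h1, ← norm_smul_radialDeriv, ← norm_smul_radialDeriv, inner_smul_left, inner_smul_right,
      real_inner_comm, hx]
    simp only [conj_trivial]
    field_simp
  -- The product rule gives `∂_α(r u_r) = u_α + D²u(e_α, x)`; symmetry of `D²u` turns the last term
  -- into `r∂_r(u_α)`.
  have hint : ∀ x ∈ halfDisc t,
      fderivWithin ℝ (fun x => inner ℝ (fderivWithin ℝ u Ω x x) (partialDeriv Ω φ 0 x)) Ω x
          (frame 0) +
        fderivWithin ℝ (fun x => inner ℝ (fderivWithin ℝ u Ω x x) (partialDeriv Ω φ 1 x)) Ω x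
          (frame 1) =
      inner ℝ (fderivWithin ℝ u Ω x x) (laplacian Ω φ x) + dilationDensity Ω φ u x := by
    intro x hxt
    have hx := hsub hxt
    have h1 : HasFDerivWithinAt (fun y => fderivWithin ℝ u Ω y y)
        ((fderivWithin ℝ u Ω x) + (secondDeriv Ω u x).flip x) halfBall x := by
      refine ((hasFDerivWithinAt_fderivWithin hDΩ hΩ hu hx).clm_apply
        (hasFDerivWithinAt_id x halfBall)).congr_fderiv ?_
      ext v; simp
    have h2 : ∀ α v, fderivWithin ℝ
        (fun x => inner ℝ (fderivWithin ℝ u Ω x x) (partialDeriv Ω φ α x)) Ω x v =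
        inner ℝ (fderivWithin ℝ u Ω x x) (secondDeriv Ω φ x v (frame α)) +
          inner ℝ (fderivWithin ℝ u Ω x v + secondDeriv Ω u x v x) (partialDeriv Ω φ α x) := by
      intro α v
      rw [fderivWithin_eq_of_hasFDerivWithinAt_halfBall hDΩ hΩ hx
        (h1.inner ℝ (hasFDerivWithinAt_partialDeriv hDΩ hΩ hφ hx α))]
      simp [fderivInnerCLM_apply]
    rw [h2, h2, laplacian_eq hDΩ hΩ hφ hx, dilationDensity_eq hDΩ hΩ hu hx, Fin.sum_univ_two,
      Fin.sum_univ_two, inner_add_right, secondDeriv_symm hDΩ hΩ hu hx (frame 0) x,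
      secondDeriv_symm hDΩ hΩ hu hx (frame 1) x, real_inner_comm (partialDeriv Ω φ 0 x),
      real_inner_comm (partialDeriv Ω φ 1 x)]
    simp only [partialDeriv]
    ring
  have i1 : IntegrableOn (fun x => inner ℝ (fderivWithin ℝ u Ω x x) (laplacian Ω φ x))
      (halfDisc t) :=
    (((contDiffOn_conformalDeriv hDΩ hΩ hu).continuousOn.inner
      (continuousOn_laplacian hDΩ hΩ hφ)).mono hsub).integrableOn_compact (isCompact_halfDisc t)
  have i2 : IntegrableOn (dilationDensity Ω φ u) (halfDisc t) :=
    ((continuousOn_dilationDensity hDΩ hΩ hφ hu).mono hsub).integrableOn_compact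
      (isCompact_halfDisc t)
  rw [← integral_add i1 i2, ← setIntegral_congr_fun (measurableSet_halfDisc t) hint, ← harc]
  exact hdiv

/-- The divergence theorem for the vector field `½ |∇φ|² x`. -/
theorem integral_dilationDensity_self (hDΩ : halfDisc 1 ⊆ Ω) (hΩ : Ω ⊆ halfPlane)
    {φ : Plane → Ambient K} (hφ : ContDiffOn ℝ 2 φ halfBall)
    {t : ℝ} (ht0 : 0 < t) (ht : t < 1) :
    arcIntegral t (fun x => t * (1 / 2 * ∑ α, ‖partialDeriv Ω φ α x‖ ^ 2)) =
      ∫ x in halfDisc t, dilationDensity Ω φ φ x := by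
  have hsub := halfDisc_subset_halfBall ht
  set e : Plane → ℝ := fun x => 1 / 2 * ∑ α, ‖partialDeriv Ω φ α x‖ ^ 2 with he
  have ce : ContDiffOn ℝ 1 e halfBall := contDiffOn_const.mul
    (ContDiffOn.sum fun α _ => (contDiffOn_partialDeriv hDΩ hΩ hφ α).norm_sq ℝ)
  have cx : ∀ i, ContDiffOn ℝ 1 (fun x : Plane => x i) halfBall := fun i =>
    (EuclideanSpace.proj i : Plane →L[ℝ] ℝ).contDiff.contDiffOn
  have cV : ∀ i, ContDiffOn ℝ 1 (fun x => e x * x i) halfBall := fun i => ce.mul (cx i)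
  have hdiv := divergence_halfDisc ht0 ht
    (fun x hx => hasFDerivWithinAt_halfBall hDΩ hΩ (cV 0) hx)
    (continuousOn_fderivWithin_halfBall hDΩ hΩ (cV 0))
    (fun x hx => hasFDerivWithinAt_halfBall hDΩ hΩ (cV 1) hx)
    (continuousOn_fderivWithin_halfBall hDΩ hΩ (cV 1))
  -- The position field is tangent to the flat side and has no flux through it.
  have hflat : flatIntegral t (fun x => e x * x 1) = 0 := by
    rw [flatIntegral_congr (v := fun _ => 0) ht0.le fun x _ hx => by rw [hx, mul_zero]]
    simp [flatIntegral]
  have harc : arcIntegral t (fun x => t⁻¹ * (e x * x 0 * x 0 + e x * x 1 * x 1)) =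
      arcIntegral t (fun x => t * e x) := by
    refine arcIntegral_congr ht0.le fun x _ hx => ?_
    have : x 0 * x 0 + x 1 * x 1 = t ^ 2 := by
      rw [← hx, EuclideanSpace.norm_sq_eq, Fin.sum_univ_two, Real.norm_eq_abs, Real.norm_eq_abs,
        sq_abs, sq_abs]
      ring
    calc t⁻¹ * (e x * x 0 * x 0 + e x * x 1 * x 1) = t⁻¹ * (e x * (x 0 * x 0 + x 1 * x 1)) := by
          ring
      _ = t * e x := by rw [this]; field_simp
  rw [hflat, sub_zero, harc] at hdiv
  rw [hdiv]
  refine setIntegral_congr_fun (measurableSet_halfDisc t) fun x hxt => ?_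
  have hx := hsub hxt
  have hp := hasFDerivWithinAt_partialDeriv hDΩ hΩ hφ hx
  have hde : ∀ v, fderivWithin ℝ e Ω x v =
      ∑ α, inner ℝ (partialDeriv Ω φ α x) (secondDeriv Ω φ x v (frame α)) := by
    intro v
    have h1 : HasFDerivWithinAt e ((1 / 2 : ℝ) • ∑ α, (2 : ℕ) • (innerSL ℝ (partialDeriv Ω φ α x)).comp
        ((secondDeriv Ω φ x).flip (frame α))) halfBall x :=
      (HasFDerivWithinAt.fun_sum fun α _ => (hp α).norm_sq).const_mul (1 / 2)
    rw [fderivWithin_eq_of_hasFDerivWithinAt_halfBall hDΩ hΩ hx h1]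
    simp
  have h2 : ∀ i v, fderivWithin ℝ (fun x => e x * x i) Ω x v =
      e x * v i + x i * fderivWithin ℝ e Ω x v := by
    intro i v
    have hprod : HasFDerivWithinAt (fun x : Plane => e x * x i) _ halfBall x :=
      (hasFDerivWithinAt_halfBall hDΩ hΩ ce hx).mul (hasFDerivAt_coord i x).hasFDerivWithinAt
    rw [fderivWithin_eq_of_hasFDerivWithinAt_halfBall hDΩ hΩ hx hprod]
    simp
  have h3 : x 0 * fderivWithin ℝ e Ω x (frame 0) + x 1 * fderivWithin ℝ e Ω x (frame 1) =
      fderivWithin ℝ e Ω x x := by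
    rw [map_eq_sum_frame (fderivWithin ℝ e Ω x) x]; simp
  have p00 : (frame 0) 0 = 1 := by simp [frame]
  have p11 : (frame 1) 1 = 1 := by simp [frame]
  simp only [h2, p00, p11]
  rw [dilationDensity_eq hDΩ hΩ hφ hx]
  simp only [inner_add_right, Finset.sum_add_distrib, ← hde x, real_inner_self_eq_norm_sq]
  rw [← h3]
  simp only [he]
  ring

/-- Near `s = 1` the curve `s ↦ s • x` stays in the flat boundary, where the maps coincide; hence so
do their derivatives along it. -/
theorem fderivWithin_conformal_eq_on_flat (hDΩ : halfDisc 1 ⊆ Ω) (hΩ : Ω ⊆ halfPlane)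
    {φ u : Plane → Ambient K} (hφ : ContDiffOn ℝ 1 φ halfBall) (hu : ContDiffOn ℝ 1 u halfBall)
    (hbd : ∀ x ∈ flatBoundary Ω, φ x = u x) {x : Plane} (hx : x ∈ halfBall) (hx1 : x 1 = 0) :
    fderivWithin ℝ φ Ω x x = fderivWithin ℝ u Ω x x := by
  have hc : HasDerivAt (fun s : ℝ => s • x) x 1 := by
    simpa using (hasDerivAt_id (1 : ℝ)).smul_const x
  have hmem : ∀ᶠ s : ℝ in 𝓝 1, s • x ∈ halfBall := by
    have h1 : ∀ᶠ s : ℝ in 𝓝 1, ‖s • x‖ < 1 := by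
      refine hc.continuousAt.norm.eventually_lt_const ?_
      simpa using hx.1
    filter_upwards [h1] with s hs
    exact ⟨hs, by simp [hx1]⟩
  have d1 : ∀ {f : Plane → Ambient K}, ContDiffOn ℝ 1 f halfBall →
      HasDerivAt (fun s : ℝ => f (s • x)) (fderivWithin ℝ f Ω x x) 1 := fun hf =>
    (hasFDerivWithinAt_halfBall hDΩ hΩ hf hx).comp_hasDerivAt_of_eq (1 : ℝ) hc hmem
      (one_smul ℝ x).symm
  refine (d1 hφ).unique ((d1 hu).congr_of_eventuallyEq ?_)
  filter_upwards [hmem] with s hs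
  exact hbd _ ⟨halfBall_subset hDΩ hs, by simp [hx1]⟩

/-- The Pohozaev identity for the map component, with the Laplacian as a free datum. -/
theorem pohozaev_map (hDΩ : halfDisc 1 ⊆ Ω) (hΩ : Ω ⊆ halfPlane)
    {φ u : Plane → Ambient K} (hφ : ContDiffOn ℝ 2 φ halfBall) (hu : ContDiffOn ℝ 2 u halfBall)
    (hbd : ∀ x ∈ flatBoundary Ω, φ x = u x) {t : ℝ} (ht0 : 0 < t) (ht : t < 1) :
    t * arcIntegral t (fun x =>
        ‖radialDeriv Ω φ x‖ ^ 2 - 1 / 2 * ∑ α, ‖partialDeriv Ω φ α x‖ ^ 2) =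
      (∫ x in halfDisc t, inner ℝ (fderivWithin ℝ φ Ω x x) (laplacian Ω φ x)) -
        (∫ x in halfDisc t, inner ℝ (fderivWithin ℝ u Ω x x) (laplacian Ω φ x)) +
        arcIntegral t (fun x => ‖x‖ * inner ℝ (radialDeriv Ω φ x) (radialDeriv Ω u x)) -
        ∫ x in halfDisc t, dilationDensity Ω φ u x := by
  have hsub := halfDisc_subset_halfBall ht
  have h1 := integral_inner_laplacian hDΩ hΩ hφ hφ ht0 ht
  have h2 := integral_inner_laplacian hDΩ hΩ hφ hu ht0 ht
  have h3 := integral_dilationDensity_self hDΩ hΩ hφ ht0 ht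
  have hflat : flatIntegral t (fun x => inner ℝ (fderivWithin ℝ φ Ω x x) (partialDeriv Ω φ 1 x)) =
      flatIntegral t (fun x => inner ℝ (fderivWithin ℝ u Ω x x) (partialDeriv Ω φ 1 x)) :=
    flatIntegral_congr ht0.le fun x hx hx1 => by
      rw [fderivWithin_conformal_eq_on_flat hDΩ hΩ (hφ.of_le (by norm_num))
        (hu.of_le (by norm_num)) hbd (hsub hx) hx1]
  have hsplit : t * arcIntegral t (fun x =>
        ‖radialDeriv Ω φ x‖ ^ 2 - 1 / 2 * ∑ α, ‖partialDeriv Ω φ α x‖ ^ 2) +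
      arcIntegral t (fun x => t * (1 / 2 * ∑ α, ‖partialDeriv Ω φ α x‖ ^ 2)) =
      arcIntegral t (fun x => ‖x‖ * inner ℝ (radialDeriv Ω φ x) (radialDeriv Ω φ x)) := by
    -- The radial derivative need not be continuous at the origin, so it is replaced by an
    -- expression that agrees with it on the arc and is continuous on the whole half disc.
    have cr : ContinuousOn (fun x => t * (‖t⁻¹ • fderivWithin ℝ φ Ω x x‖ ^ 2 -
        1 / 2 * ∑ α, ‖partialDeriv Ω φ α x‖ ^ 2)) (halfDisc t) := by
      refine ContinuousOn.mono ?_ hsub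
      exact continuousOn_const.mul ((((contDiffOn_conformalDeriv hDΩ hΩ hφ).continuousOn.const_smul
        t⁻¹).norm.pow 2).sub (continuousOn_const.mul (continuousOn_finsetSum _ fun α _ =>
          (contDiffOn_partialDeriv hDΩ hΩ hφ α).continuousOn.norm.pow 2)))
    have cE : ContinuousOn (fun x => t * (1 / 2 * ∑ α, ‖partialDeriv Ω φ α x‖ ^ 2))
        (halfDisc t) := by
      refine ContinuousOn.mono ?_ hsub
      exact continuousOn_const.mul (continuousOn_const.mul (continuousOn_finsetSum _ fun α _ =>
          (contDiffOn_partialDeriv hDΩ hΩ hφ α).continuousOn.norm.pow 2))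
    have hr : ∀ x : Plane, ‖x‖ = t → radialDeriv Ω φ x = t⁻¹ • fderivWithin ℝ φ Ω x x := by
      intro x hx
      rw [← norm_smul_radialDeriv, smul_smul, hx, inv_mul_cancel₀ ht0.ne', one_smul]
    have e1 : t * arcIntegral t (fun x =>
        ‖radialDeriv Ω φ x‖ ^ 2 - 1 / 2 * ∑ α, ‖partialDeriv Ω φ α x‖ ^ 2) =
        arcIntegral t (fun x => t * (‖t⁻¹ • fderivWithin ℝ φ Ω x x‖ ^ 2 -
          1 / 2 * ∑ α, ‖partialDeriv Ω φ α x‖ ^ 2)) := by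
      have e2 : t * arcIntegral t (fun x =>
          ‖radialDeriv Ω φ x‖ ^ 2 - 1 / 2 * ∑ α, ‖partialDeriv Ω φ α x‖ ^ 2) =
          arcIntegral t (fun x => t * (‖radialDeriv Ω φ x‖ ^ 2 -
            1 / 2 * ∑ α, ‖partialDeriv Ω φ α x‖ ^ 2)) := by
        unfold arcIntegral
        rw [← intervalIntegral.integral_const_mul]
        rfl
      rw [e2]
      exact arcIntegral_congr ht0.le fun x _ hx => by rw [hr x hx]
    rw [e1, ← arcIntegral_add cr cE ht0.le]
    refine arcIntegral_congr ht0.le fun x _ hx => ?_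
    rw [← hr x hx, real_inner_self_eq_norm_sq, hx]
    ring
  -- Subtracting the identities for `u` and `φ` eliminates the flat integral; the energy identity
  -- then replaces the dilation density of `φ` with itself by an arc integral.
  rw [hflat] at h1
  linarith

end MapPart

/-! ### Pohozaev identity for the spinor component. -/

section SpinorPart

open Filter Topology Set

variable {K n : ℕ} {N : Set (Ambient K)} {Ω : Set Plane}

/-- The Hermitian product of twisted spinors as a real bilinear map. -/
noncomputable def hermitianBilin (K : ℕ) : TwistedSpinor K →L[ℝ] TwistedSpinor K →L[ℝ] ℂ :=
  (LinearMap.mk₂ ℝ (fun ψ η : TwistedSpinor K => inner ℂ ψ η)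
    (fun _ _ _ => inner_add_left _ _ _)
    (fun c ψ η => by simp [inner_smul_left_eq_smul])
    (fun _ _ _ => inner_add_right _ _ _)
    (fun c ψ η => by simp [inner_smul_right_eq_smul])).toContinuousBilinearMap

@[simp]
theorem hermitianBilin_apply (ψ η : TwistedSpinor K) : hermitianBilin K ψ η = inner ℂ ψ η := rfl

/-- The rotation `x ↦ ∂_θ` by a right angle. -/
noncomputable def angularCLM : Plane →L[ℝ] Plane :=
  LinearMap.toContinuousLinearMap
    { toFun := angularVec
      map_add' := fun x y => by ext i; fin_cases i <;> simp [angularVec]; ring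
      map_smul' := fun c x => by ext i; fin_cases i <;> simp [angularVec] }

@[simp]
theorem angularCLM_apply (x : Plane) : angularCLM x = angularVec x := rfl

/-- Green's theorem for the 1-form `⟨ψ, ∂_θ·dψ⟩`. -/
theorem green_spinor (hDΩ : halfDisc 1 ⊆ Ω) (hΩ : Ω ⊆ halfPlane) {ψ : Plane → TwistedSpinor K}
    (hψ : ContDiffOn ℝ 1 ψ halfBall) {t : ℝ} (ht0 : 0 < t) (ht : t < 1) :
    arcIntegral t (fun x => ‖x‖⁻¹ •
        inner ℂ (ψ x) (clifford (angularVec x) (fderivWithin ℝ ψ Ω x (angularVec x)))) +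
      flatIntegral t (fun x =>
        inner ℂ (ψ x) (clifford (angularVec x) (fderivWithin ℝ ψ Ω x (frame 0)))) =
      ∫ x in halfDisc t,
        (inner ℂ (ψ x) (clifford (frame 0) (fderivWithin ℝ ψ Ω x (frame 0))) +
          inner ℂ (ψ x) (clifford (frame 1) (fderivWithin ℝ ψ Ω x (frame 1))) +
          ((2 * (inner ℂ (fderivWithin ℝ ψ Ω x (frame 0))
            (clifford (angularVec x) (fderivWithin ℝ ψ Ω x (frame 1)))).re : ℝ) : ℂ)) := by
  have hd := fun x hx => hasFDerivWithinAt_halfBall hDΩ hΩ hψ (x := x) hx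
  have cd := continuousOn_fderivWithin_halfBall hDΩ hΩ hψ
  -- Green's theorem is used with `f = -∂_θ·ψ` and `g = ψ`; skew-adjointness turns `⟨f, dg⟩` into
  -- `⟨ψ, ∂_θ·dψ⟩`. Differentiating the coefficient `∂_θ` produces the Dirac terms.
  have hf : ∀ x ∈ halfBall, HasFDerivWithinAt (fun y => -cliffordBilin K (angularCLM y) (ψ y))
      (-((cliffordBilin K).precompR Plane (angularCLM x) (fderivWithin ℝ ψ Ω x) +
        (cliffordBilin K).precompL Plane angularCLM (ψ x))) halfBall x := fun x hx =>
    ((cliffordBilin K).hasFDerivWithinAt_of_bilinear angularCLM.hasFDerivWithinAt (hd x hx)).neg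
  have cf' : ContinuousOn (fun x =>
      -((cliffordBilin K).precompR Plane (angularCLM x) (fderivWithin ℝ ψ Ω x) +
        (cliffordBilin K).precompL Plane angularCLM (ψ x))) halfBall := by
    refine ((((cliffordBilin K).precompR Plane).continuous.comp
      angularCLM.continuous).continuousOn.clm_apply cd).add
      (continuousOn_const.clm_apply hψ.continuousOn) |>.neg
  have g := green_halfDisc (hermitianBilin K) ht0 ht hf cf' hd cd
  have e : ∀ x η, hermitianBilin K (-cliffordBilin K (angularCLM x) (ψ x)) η =
      inner ℂ (ψ x) (clifford (angularVec x) η) := by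
    intro x η
    rw [hermitianBilin_apply, inner_neg_left, cliffordBilin_apply, angularCLM_apply,
      inner_clifford_left, neg_neg]
  simp only [e] at g
  rw [g]
  congr 1; funext x
  have a0 : angularVec (frame 0) = frame 1 := by
    ext i; fin_cases i <;> simp [angularVec, frame]
  have a1 : angularVec (frame 1) = (-1 : ℝ) • frame 0 := by
    ext i; fin_cases i <;> simp [angularVec, frame]
  simp only [neg_apply, add_apply, ContinuousLinearMap.precompR_apply,
    ContinuousLinearMap.precompL_apply, ContinuousLinearMap.compL_apply,
    ContinuousLinearMap.comp_apply, cliffordBilin_apply, angularCLM_apply, a0, a1,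
    hermitianBilin_apply, clifford_smul_left]
  simp only [neg_add, inner_add_left, inner_neg_left, neg_smul, one_smul, neg_neg,
    inner_clifford_left]
  -- The two products of first derivatives are negative conjugates of each other, so their
  -- difference is twice a real part.
  have hconj : inner ℂ (fderivWithin ℝ ψ Ω x (frame 1))
      (clifford (angularVec x) (fderivWithin ℝ ψ Ω x (frame 0))) =
      -(starRingEnd ℂ) (inner ℂ (fderivWithin ℝ ψ Ω x (frame 0))
        (clifford (angularVec x) (fderivWithin ℝ ψ Ω x (frame 1)))) := by
    rw [inner_conj_symm, inner_clifford_left, neg_neg]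
  rw [hconj, ← Complex.add_conj]
  ring

theorem integrableOn_inner_of_continuousOn {𝕜 E : Type*} [RCLike 𝕜] [NormedAddCommGroup E]
    [InnerProductSpace 𝕜 E] {f g : Plane → E} {s : Set Plane}
    (hs : IsCompact s) (hf : ContinuousOn f s) (hg : IntegrableOn g s) :
    IntegrableOn (fun x => inner 𝕜 (f x) (g x)) s := by
  obtain ⟨C, hC⟩ := hs.exists_bound_of_continuousOn hf
  refine Integrable.mono' (hg.norm.const_mul C)
    ((hf.aestronglyMeasurable_of_isCompact hs hs.isClosed.measurableSet).inner
      hg.aestronglyMeasurable) ?_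
  filter_upwards [ae_restrict_mem hs.isClosed.measurableSet] with x hx
  exact (norm_inner_le_norm _ _).trans (mul_le_mul_of_nonneg_right (hC x hx) (norm_nonneg _))

variable {φ : Plane → Ambient K} {ψ : Plane → TwistedSpinor K} {τ : Plane → Ambient K}
  {h : Plane → TwistedSpinor K}

/-- Almost everywhere this is `τ - Δφ`, an integrable function minus a continuous one; no regularity
of `A` along `φ` has to be established. -/
theorem IsApproxDiracHarmonic.integrableOn_curvatureTerms (H : IsApproxDiracHarmonic N Ω φ ψ τ h)
    (hDΩ : halfDisc 1 ⊆ Ω) (hΩ : Ω ⊆ halfPlane) {t : ℝ} (ht : t < 1) :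
    IntegrableOn (fun x => secondFFTerm N Ω φ x - spinorShapeTerm N Ω φ ψ x) (halfDisc t) := by
  have hsub := halfDisc_subset_halfBall ht
  have hsubΩ := hsub.trans (halfBall_subset hDΩ)
  have hφ := H.contDiffOn_map.mono (halfBall_subset hDΩ)
  have i1 : IntegrableOn (laplacian Ω φ) (halfDisc t) :=
    ((continuousOn_laplacian hDΩ hΩ hφ).mono hsub).integrableOn_compact (isCompact_halfDisc t)
  refine ((H.integrableOn_tau.mono_set hsubΩ).sub i1).congr ?_
  filter_upwards [ae_restrict_of_ae_restrict_of_subset hsubΩ H.tau_eq] with x hx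
  rw [Pi.sub_apply, hx]
  abel

theorem IsApproxDiracHarmonic.integrableOn_diracAlong (H : IsApproxDiracHarmonic N Ω φ ψ τ h)
    (hDΩ : halfDisc 1 ⊆ Ω) {t : ℝ} (ht : t < 1) :
    IntegrableOn (diracAlong N Ω φ ψ) (halfDisc t) := by
  have hsubΩ := (halfDisc_subset_halfBall ht).trans (halfBall_subset hDΩ)
  exact (H.integrableOn_h.mono_set hsubΩ).congr
    (ae_restrict_of_ae_restrict_of_subset hsubΩ H.h_eq)

theorem IsApproxDiracHarmonic.inner_curvatureTerms (H : IsApproxDiracHarmonic N Ω φ ψ τ h)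
    (hDΩ : halfDisc 1 ⊆ Ω) (hΩ : Ω ⊆ halfPlane) {x : Plane} (hx : x ∈ halfBall) :
    inner ℝ (fderivWithin ℝ φ Ω x x) (secondFFTerm N Ω φ x - spinorShapeTerm N Ω φ ψ x) =
      -inner ℝ (fderivWithin ℝ φ Ω x x) (spinorShapeTerm N Ω φ ψ x) := by
  have hxΩ := halfBall_subset hDΩ hx
  rw [inner_sub_right, inner_secondFFTerm (fderivWithin_mem_tangentSpaceAt
    (uniqueDiffWithinAt_of_mem_halfBall hDΩ hΩ hx)
    (H.contDiffOn_map.differentiableOn (by simp) x hxΩ).hasFDerivWithinAt H.mapsTo), zero_sub]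

/-- The Pohozaev identity for the spinor component. -/
theorem IsApproxDiracHarmonic.pohozaev_spinor (hN : IsSmoothSubmanifold n N)
    (H : IsApproxDiracHarmonic N Ω φ ψ τ h)
    (hDΩ : halfDisc 1 ⊆ Ω) (hΩ : Ω ⊆ halfPlane) {t : ℝ} (ht0 : 0 < t) (ht : t < 1) :
    arcIntegral t (fun x =>
        inner ℂ (ψ x) (clifford (‖x‖⁻¹ • angularVec x) (covDeriv N Ω φ ψ x (angularVec x)))) +
      flatIntegral t (fun x =>
        inner ℂ (ψ x) (clifford (frame 1) (‖x‖ • covDeriv N Ω φ ψ x (radialVec x)))) =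
      (∫ x in halfDisc t, inner ℂ (ψ x) (diracAlong N Ω φ ψ x)) +
        2 * (((∫ x in halfDisc t, inner ℂ (diracAlong N Ω φ ψ x)
          (‖x‖ • covDeriv N Ω φ ψ x (radialVec x))).re : ℝ) : ℂ) +
        2 * ((∫ x in halfDisc t,
          inner ℝ (fderivWithin ℝ φ Ω x x) (spinorShapeTerm N Ω φ ψ x) : ℝ) : ℂ) := by
  have hsub := halfDisc_subset_halfBall ht
  have hBΩ := halfBall_subset hDΩ
  have hψ := H.contDiffOn_spinor.mono hBΩ
  have hφ := H.contDiffOn_map.mono hBΩ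
  have hK := isCompact_halfDisc t
  have cd := (continuousOn_fderivWithin_halfBall hDΩ hΩ hψ).mono hsub
  have g := green_spinor hDΩ hΩ hψ ht0 ht
  have harc : arcIntegral t (fun x =>
      inner ℂ (ψ x) (clifford (‖x‖⁻¹ • angularVec x) (covDeriv N Ω φ ψ x (angularVec x)))) =
      arcIntegral t (fun x => ‖x‖⁻¹ •
        inner ℂ (ψ x) (clifford (angularVec x) (fderivWithin ℝ ψ Ω x (angularVec x)))) :=
    arcIntegral_congr ht0.le fun x hx _ => by
      rw [inner_clifford_covDeriv H.isSection (hBΩ (hsub hx)), clifford_smul_left,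
        inner_smul_right_eq_smul]
  -- On the flat side `x = x¹e₁` and `∂_θ = x¹e₂`, so the factor `x¹` can be moved from the Clifford
  -- vector into the direction of differentiation.
  have hflat : flatIntegral t (fun x =>
      inner ℂ (ψ x) (clifford (frame 1) (‖x‖ • covDeriv N Ω φ ψ x (radialVec x)))) =
      flatIntegral t (fun x =>
        inner ℂ (ψ x) (clifford (angularVec x) (fderivWithin ℝ ψ Ω x (frame 0)))) :=
    flatIntegral_congr ht0.le fun x hx hx1 => by
      have e1 : x = x 0 • frame 0 := by
        conv_lhs => rw [eq_sum_frame x, hx1, zero_smul, add_zero]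
      have e2 : angularVec x = x 0 • frame 1 := by
        ext i; fin_cases i <;> simp [angularVec, frame, hx1]
      rw [norm_smul_covDeriv_radialVec, inner_clifford_covDeriv H.isSection (hBΩ (hsub hx)), e2,
        clifford_smul_left, ← clifford_smul_right, ← map_smul, ← e1]
  rw [harc, hflat, g]
  have iD : IntegrableOn (fun x => inner ℂ (ψ x) (diracAlong N Ω φ ψ x)) (halfDisc t) :=
    integrableOn_inner_of_continuousOn hK (hψ.continuousOn.mono hsub)
      (H.integrableOn_diracAlong hDΩ ht)
  have iR : IntegrableOn (fun x => inner ℂ (diracAlong N Ω φ ψ x)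
      (‖x‖ • covDeriv N Ω φ ψ x (radialVec x))) (halfDisc t) := by
    have i1 : IntegrableOn (fun x => inner ℂ (fderivWithin ℝ ψ Ω x x) (diracAlong N Ω φ ψ x))
        (halfDisc t) :=
      integrableOn_inner_of_continuousOn hK (cd.clm_apply continuousOn_id)
        (H.integrableOn_diracAlong hDΩ ht)
    have i2 := Complex.conjCLE.toContinuousLinearMap.integrable_comp i1
    refine i2.congr (Eventually.of_forall fun x => ?_)
    simp only [norm_smul_covDeriv_radialVec, inner_diracAlong_covDeriv]
    exact inner_conj_symm _ _
  -- Only the combined curvature term is known to be integrable; pairing it with `rφ_r` annihilates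
  -- the normal-valued `A(dφ, dφ)` and isolates the spinorial force.
  have iS : IntegrableOn (fun x =>
      inner ℝ (fderivWithin ℝ φ Ω x x) (spinorShapeTerm N Ω φ ψ x)) (halfDisc t) := by
    have i1 : IntegrableOn (fun x => inner ℝ (fderivWithin ℝ φ Ω x x)
        (secondFFTerm N Ω φ x - spinorShapeTerm N Ω φ ψ x)) (halfDisc t) :=
      integrableOn_inner_of_continuousOn hK
        ((contDiffOn_conformalDeriv hDΩ hΩ hφ).continuousOn.mono hsub)
        (H.integrableOn_curvatureTerms hDΩ hΩ ht)
    refine i1.neg.congr ?_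
    filter_upwards [ae_restrict_mem (measurableSet_halfDisc t)] with x hx
    rw [Pi.neg_apply, H.inner_curvatureTerms hDΩ hΩ (hsub hx), neg_neg]
  have hpt : ∀ x ∈ halfDisc t,
      (inner ℂ (ψ x) (clifford (frame 0) (fderivWithin ℝ ψ Ω x (frame 0))) +
          inner ℂ (ψ x) (clifford (frame 1) (fderivWithin ℝ ψ Ω x (frame 1))) +
          ((2 * (inner ℂ (fderivWithin ℝ ψ Ω x (frame 0))
            (clifford (angularVec x) (fderivWithin ℝ ψ Ω x (frame 1)))).re : ℝ) : ℂ)) =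
      inner ℂ (ψ x) (diracAlong N Ω φ ψ x) +
        ((2 * (inner ℂ (diracAlong N Ω φ ψ x)
          (‖x‖ • covDeriv N Ω φ ψ x (radialVec x))).re +
          2 * inner ℝ (fderivWithin ℝ φ Ω x x) (spinorShapeTerm N Ω φ ψ x) : ℝ) : ℂ) := by
    intro x hx
    have hxΩ := hBΩ (hsub hx)
    rw [re_inner_fderivWithin_angular hN hxΩ
      (uniqueDiffWithinAt_of_mem_halfBall hDΩ hΩ (hsub hx))
      (H.contDiffOn_map.differentiableOn (by simp) x hxΩ)
      (H.contDiffOn_spinor.differentiableOn (by simp) x hxΩ) H.mapsTo H.isSection,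
      inner_diracAlong H.isSection hxΩ, mul_add]
  rw [setIntegral_congr_fun (measurableSet_halfDisc t) hpt]
  have iRe : IntegrableOn (fun x => (inner ℂ (diracAlong N Ω φ ψ x)
      (‖x‖ • covDeriv N Ω φ ψ x (radialVec x))).re) (halfDisc t) := iR.re
  have iTot : IntegrableOn (fun x => 2 * (inner ℂ (diracAlong N Ω φ ψ x)
      (‖x‖ • covDeriv N Ω φ ψ x (radialVec x))).re +
      2 * inner ℝ (fderivWithin ℝ φ Ω x x) (spinorShapeTerm N Ω φ ψ x)) (halfDisc t) :=
    (iRe.const_mul 2).add (iS.const_mul 2)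
  have hre : (∫ x in halfDisc t, (inner ℂ (diracAlong N Ω φ ψ x)
      (‖x‖ • covDeriv N Ω φ ψ x (radialVec x))).re) =
      (∫ x in halfDisc t, inner ℂ (diracAlong N Ω φ ψ x)
        (‖x‖ • covDeriv N Ω φ ψ x (radialVec x))).re := integral_re iR
  have iC : IntegrableOn (fun x => ((2 * (inner ℂ (diracAlong N Ω φ ψ x)
      (‖x‖ • covDeriv N Ω φ ψ x (radialVec x))).re +
      2 * inner ℝ (fderivWithin ℝ φ Ω x x) (spinorShapeTerm N Ω φ ψ x) : ℝ) : ℂ))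
      (halfDisc t) := iTot.ofReal
  rw [integral_add iD iC, integral_complex_ofReal,
    integral_add (iRe.const_mul 2) (iS.const_mul 2), integral_const_mul, integral_const_mul, hre]
  push_cast
  ring

end SpinorPart

end DiracHarmonic

/-! ### Combination of the map and spinor identities. -/

open DiracHarmonic in
theorem lemma2p2 {K n : ℕ} (N : Set (Ambient K)) (hN : IsCompact N)
    (hNn : IsSmoothSubmanifold n N)
    (Ω : Set Plane) (hDΩ : halfDisc 1 ⊆ Ω) (hΩ : Ω ⊆ halfPlane)
    (φ : Plane → Ambient K) (ψ : Plane → TwistedSpinor K)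
    (τ : Plane → Ambient K) (h : Plane → TwistedSpinor K)
    (hφψ : IsApproxDiracHarmonic N Ω φ ψ τ h)
    (s : ℤˣ) (φ₀ : Plane → Ambient K) (χ : Plane → TwistedSpinor K)
    (hφ₀ : ContDiffOn ℝ 2 φ₀ Ω)
    (hbd : HasBoundaryData s Ω φ ψ φ₀ χ)
    (t : ℝ) (ht0 : 0 < t) (ht : t < 1 / 2) :
    ((t * arcIntegral t (fun x =>
        ‖radialDeriv Ω φ x‖ ^ 2 - 1 / 2 * ∑ α, ‖partialDeriv Ω φ α x‖ ^ 2) : ℝ) : ℂ) =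
      1 / 2 * arcIntegral t (fun x =>
          inner ℂ (ψ x) (clifford (‖x‖⁻¹ • angularVec x) (covDeriv N Ω φ ψ x (angularVec x))))
      - 1 / 2 * (∫ x in halfDisc t, inner ℂ (ψ x) (diracAlong N Ω φ ψ x))
      - (((∫ x in halfDisc t, inner ℂ (diracAlong N Ω φ ψ x)
          (‖x‖ • covDeriv N Ω φ ψ x (radialVec x))).re : ℝ) : ℂ)
      + ((∫ x in halfDisc t,
          inner ℝ (‖x‖ • radialDeriv Ω (fun y => φ y - φ₀ y) x) (τ x) : ℝ) : ℂ)
      + 1 / 2 * flatIntegral t (fun x =>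
          inner ℂ (ψ x) (clifford (frame 1) (‖x‖ • covDeriv N Ω φ ψ x (radialVec x))))
      + ((arcIntegral t (fun x =>
          ‖x‖ * inner ℝ (radialDeriv Ω φ x) (radialDeriv Ω φ₀ x)) : ℝ) : ℂ)
      - ((∫ x in halfDisc t, ∑ α, inner ℝ (partialDeriv Ω φ α x)
          (partialDeriv Ω φ₀ α x + ‖x‖ • radialDeriv Ω (partialDeriv Ω φ₀ α) x) : ℝ) : ℂ)
      + ((∫ x in halfDisc t, inner ℝ (‖x‖ • radialDeriv Ω φ₀ x)
          (secondFFTerm N Ω φ x - spinorShapeTerm N Ω φ ψ x) : ℝ) : ℂ) := by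
  have ht1 : t < 1 := by linarith
  have hsub := halfDisc_subset_halfBall ht1
  have hBΩ := halfBall_subset hDΩ
  have hφ := hφψ.contDiffOn_map.mono hBΩ
  have hu := hφ₀.mono hBΩ
  have hK := isCompact_halfDisc t
  have cφ := (contDiffOn_conformalDeriv hDΩ hΩ hφ).continuousOn.mono hsub
  have cu := (contDiffOn_conformalDeriv hDΩ hΩ hu).continuousOn.mono hsub
  have iL : IntegrableOn (laplacian Ω φ) (halfDisc t) :=
    ((continuousOn_laplacian hDΩ hΩ hφ).mono hsub).integrableOn_compact hK
  have iA := hφψ.integrableOn_curvatureTerms hDΩ hΩ ht1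
  have hmap := pohozaev_map hDΩ hΩ hφ hu hbd.dirichlet ht0 ht1
  have hspin := hφψ.pohozaev_spinor hNn hDΩ hΩ ht0 ht1
  -- The equation for `τ` is inserted. Against `rφ_r` only the spinorial force survives from the
  -- curvature terms, while against `r(φ₀)_r` both terms remain.
  have hτ : (∫ x in halfDisc t,
      inner ℝ (‖x‖ • radialDeriv Ω (fun y => φ y - φ₀ y) x) (τ x)) =
      (∫ x in halfDisc t, inner ℝ (fderivWithin ℝ φ Ω x x) (laplacian Ω φ x)) -
        (∫ x in halfDisc t, inner ℝ (fderivWithin ℝ φ₀ Ω x x) (laplacian Ω φ x)) -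
        (∫ x in halfDisc t, inner ℝ (fderivWithin ℝ φ Ω x x) (spinorShapeTerm N Ω φ ψ x)) -
        ∫ x in halfDisc t, inner ℝ (fderivWithin ℝ φ₀ Ω x x)
          (secondFFTerm N Ω φ x - spinorShapeTerm N Ω φ ψ x) := by
    have j1 := integrableOn_inner_of_continuousOn (𝕜 := ℝ) hK cφ iL
    have j2 := integrableOn_inner_of_continuousOn (𝕜 := ℝ) hK cu iL
    have j3 := integrableOn_inner_of_continuousOn (𝕜 := ℝ) hK cφ iA
    have j4 := integrableOn_inner_of_continuousOn (𝕜 := ℝ) hK cu iA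
    have e3 : (∫ x in halfDisc t,
        inner ℝ (fderivWithin ℝ φ Ω x x) (spinorShapeTerm N Ω φ ψ x)) =
        -∫ x in halfDisc t, inner ℝ (fderivWithin ℝ φ Ω x x)
          (secondFFTerm N Ω φ x - spinorShapeTerm N Ω φ ψ x) := by
      rw [← integral_neg]
      refine setIntegral_congr_fun (measurableSet_halfDisc t) fun x hx => ?_
      simp only [hφψ.inner_curvatureTerms hDΩ hΩ (hsub hx), neg_neg]
    rw [e3, sub_neg_eq_add, ← integral_sub' j1 j2, ← integral_add' (j1.sub j2) j3,
      ← integral_sub' ((j1.sub j2).add j3) j4]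
    refine integral_congr_ae ?_
    filter_upwards [ae_restrict_of_ae_restrict_of_subset (hsub.trans hBΩ) hφψ.tau_eq,
      ae_restrict_mem (measurableSet_halfDisc t)] with x hx hxt
    have hxΩ := hBΩ (hsub hxt)
    have hd : fderivWithin ℝ (fun y => φ y - φ₀ y) Ω x =
        fderivWithin ℝ φ Ω x - fderivWithin ℝ φ₀ Ω x :=
      fderivWithin_fun_sub (uniqueDiffWithinAt_of_mem_halfBall hDΩ hΩ (hsub hxt))
        (hφψ.contDiffOn_map.differentiableOn (by simp) x hxΩ)
        (hφ₀.differentiableOn (by simp) x hxΩ)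
    simp only [Pi.add_apply, Pi.sub_apply]
    rw [norm_smul_radialDeriv, hd, hx, sub_apply, inner_sub_left, add_sub_assoc, inner_add_right,
      inner_add_right]
    ring
  have hlast : (∫ x in halfDisc t, inner ℝ (‖x‖ • radialDeriv Ω φ₀ x)
      (secondFFTerm N Ω φ x - spinorShapeTerm N Ω φ ψ x)) =
      ∫ x in halfDisc t, inner ℝ (fderivWithin ℝ φ₀ Ω x x)
        (secondFFTerm N Ω φ x - spinorShapeTerm N Ω φ ψ x) := by
    simp only [norm_smul_radialDeriv]
  have hdil : (∫ x in halfDisc t, ∑ α, inner ℝ (partialDeriv Ω φ α x)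
      (partialDeriv Ω φ₀ α x + ‖x‖ • radialDeriv Ω (partialDeriv Ω φ₀ α) x)) =
      ∫ x in halfDisc t, dilationDensity Ω φ φ₀ x := rfl
  rw [hmap, hτ, hlast, hdil]
  push_cast
  -- The spinor identity contains twice the integral of the spinorial force against `rφ_r`; half of
  -- it cancels the single copy left by the map part.
  linear_combination (-1 / 2 : ℂ) * hspin
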